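/- **Theorem 1.2.** Let $\nu>0$, $\alpha>\tfrac12$ and let $k\ge 1$ be an integer. Let $g_\alpha(t,\cdot)$, $t>0$, be the fractional heat kernel on $\mathbb R^2$, that is $\int_{\mathbb R^2} g_\alpha(t,x)e^{-i\xi\cdot x}\,dx=e^{-\nu t|\xi|^{2\alpha}}$, and let $K=(K^1,K^2)$ with $K(x)=\dfrac{(-x_2,x_1)}{2\pi|x|^3}$. Write $C^k_b(\mathbb R^2)$ for the $k$ times continuously differentiable functions whose partial derivatives $D^\beta f$, $|\beta|\le k$, are all bounded. Let $\theta_0\in C^k_b(\mathbb R^2)$ and $u_0\in (C^k_b(\mathbb R^2))^2$ satisfy $u_0=\mathrm{p.v.}\,K*\theta_0$, i.e. for every $x\in\mathbb R^2$ $$u_0(x)=\lim_{\varepsilon\to0^+,\;R\to\infty}\int_{\varepsilon<|x-y|<R}K(x-y)\,\theta_0(y)\,dy .$$ Let $T\in(0,\infty)$ and let $(\theta,u)\in L^\infty([0,T]\times\mathbb R^2)\times (L^\infty([0,T]\times\mathbb R^2))^2$ be a mild solution on $[0,T]$ of the dissipative surface quasi-geostrophic equation with data $(\theta_0,u_0)$.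 This means that $\theta(0)=\theta_0$, $u(0)=u_0$, and, for every $t\in(0,T]$, almost every $x\in\mathbb R^2$ and $i=1,2$, $$\theta(t,x)=(g_\alpha(t)*\theta_0)(x)-\int_0^t\sum_{j=1}^2\bigl(\partial_jg_\alpha(t-s)*(\theta u_j)(s)\bigr)(x)\,ds,$$ $$u_i(t,x)=(g_\alpha(t)*u_{0,i})(x)-\int_0^t\sum_{j=1}^2\bigl((\mathrm{p.v.}\,K^i*\partial_jg_\alpha(t-s))*(\theta u_j)(s)\bigr)(x)\,ds .$$ Then $\theta$ and $u$ have all spatial derivatives of order at most $k$, bounded on $[0,T]$: there is a constant $M$ such that for every $t\in[0,T]$ the functions $\theta(t)$, $u_1(t)$, $u_2(t)$ agree almost everywhere with $C^k$ functions all of whose partial derivatives $D^\beta$, $|\beta|\le k$, are bounded by $M$ on $\mathbb R^2$. -/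

import Mathlib

open MeasureTheory Filter Topology
open scoped FourierTransform

noncomputable section

namespace DissipativeSQG

/-- The plane `ℝ²` with its Euclidean norm. -/
abbrev Plane : Type := EuclideanSpace ℝ (Fin 2)

/-- The `i`-th standard basis vector of the plane. -/
def basisVec (i : Fin 2) : Plane := EuclideanSpace.single i (1 : ℝ)

/-- The partial derivative `∂ᵢ f`. -/
def partialDeriv (i : Fin 2) (f : Plane → ℝ) : Plane → ℝ :=
  fun x => fderiv ℝ f x (basisVec i)

/-- The iterated partial derivative `D^β f` for a multi-index `β ∈ ℕ²`. -/
def multiDeriv (β : Fin 2 → ℕ) (f : Plane → ℝ) : Plane → ℝ :=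
  (partialDeriv 0)^[β 0] ((partialDeriv 1)^[β 1] f)

/-- `f ∈ C^k_b(ℝ²)`: `f` is `k` times continuously differentiable and all its partial
derivatives of order at most `k` are bounded. -/
def IsCkb (k : ℕ) (f : Plane → ℝ) : Prop :=
  ContDiff ℝ k f ∧
    ∀ β : Fin 2 → ℕ, β 0 + β 1 ≤ k → ∃ C : ℝ, ∀ x, |multiDeriv β f x| ≤ C

/-- The convolution `(f * h)(x) = ∫ f(x - y) h(y) dy`. -/
def conv (f h : Plane → ℝ) (x : Plane) : ℝ := ∫ y, f (x - y) * h y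

/-- The fractional heat kernel `g_α(t, ·)`, whose Fourier transform
`∫ g_α(t, x) e^{-i ξ·x} dx` is `exp (-ν t |ξ|^{2α})`. Mathlib's inverse Fourier transform is
`∫ e^{2π i ξ·x} F(ξ) dξ`, hence the factor `2π` in front of the frequency. The integral is real,
because its integrand is Hermitian symmetric. -/
def heatKernel (ν α t : ℝ) (x : Plane) : ℝ :=
  (𝓕⁻ (fun ξ : Plane => ((Real.exp (-(ν * t * (2 * Real.pi * ‖ξ‖) ^ (2 * α))) : ℝ) : ℂ)) x).re

/-- The semigroup `G_α(t) f = g_α(t) * f`. -/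
def heatSemigroup (ν α t : ℝ) (f : Plane → ℝ) : Plane → ℝ :=
  conv (heatKernel ν α t) f

/-- The components of the SQG kernel `K(x) = ∇^⊥ψ(x) = (-x₂, x₁) / (2π |x|³)`, where
`ψ(x) = -1 / (2π |x|)` and `∇^⊥ = (-∂₂, ∂₁)`. -/
def kernelK (i : Fin 2) (x : Plane) : ℝ :=
  (![-(x 1), x 0] i) / (2 * Real.pi * ‖x‖ ^ 3)

/-- The truncated integral `∫_{ε < |x - y| < R} Kⁱ(x - y) f(y) dy`, with `p = (ε, R)`. -/
def truncConvK (i : Fin 2) (f : Plane → ℝ) (x : Plane) (p : ℝ × ℝ) : ℝ :=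
  ∫ y in {y : Plane | p.1 < ‖x - y‖ ∧ ‖x - y‖ < p.2}, kernelK i (x - y) * f y

/-- The principal value integral `(p.v. Kⁱ * f)(x)` exists and is equal to `l`; the limit is a joint
one, as `ε → 0⁺` and `R → ∞`. -/
def HasPVConvK (i : Fin 2) (f : Plane → ℝ) (x : Plane) (l : ℝ) : Prop :=
  Tendsto (truncConvK i f x) (𝓝[>] (0 : ℝ) ×ˢ atTop) (𝓝 l)

/-- The function `p.v. Kⁱ * f`. -/
def pvConvK (i : Fin 2) (f : Plane → ℝ) (x : Plane) : ℝ :=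
  limUnder (𝓝[>] (0 : ℝ) ×ˢ atTop) (truncConvK i f x)

/-- `∇G_α(t) · p = ∑ⱼ ∂ⱼ g_α(t) * pⱼ`, for a vector field `p`. -/
def gradHeat (ν α t : ℝ) (p : Plane → Plane) (x : Plane) : ℝ :=
  ∑ j : Fin 2, conv (partialDeriv j (heatKernel ν α t)) (fun y => p y j) x

/-- The `i`-th component `∑ⱼ (Kⁱ * ∂ⱼ g_α(t)) * pⱼ` of `(K * ∇G_α(t)) · p`, for a vector
field `p`. -/
def gradHeatK (ν α t : ℝ) (i : Fin 2) (p : Plane → Plane) (x : Plane) : ℝ :=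
  ∑ j : Fin 2,
    conv (pvConvK i (partialDeriv j (heatKernel ν α t))) (fun y => p y j) x

/-- `(θ, u)` is a mild solution of the dissipative SQG equation on `[0, T]` with initial data
`(θ₀, u₀)`: it is essentially bounded on `[0, T] × ℝ²`, equals `(θ₀, u₀)` at time zero, and
satisfies the two Duhamel equations at every time `t ∈ (0, T]`. At each time the functions
`θ t` and `u t` are regarded as elements of `L^∞(ℝ²)`, so identities hold for almost every `x`. -/
structure IsMildSolution (ν α T : ℝ) (θ₀ : Plane → ℝ) (u₀ : Plane → Plane)
    (θ : ℝ → Plane → ℝ) (u : ℝ → Plane → Plane) : Prop where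
  theta_memLp : MemLp (fun z : ℝ × Plane => θ z.1 z.2) ⊤
    ((volume.restrict (Set.Icc 0 T)).prod volume)
  u_memLp : MemLp (fun z : ℝ × Plane => u z.1 z.2) ⊤
    ((volume.restrict (Set.Icc 0 T)).prod volume)
  theta_zero : θ 0 =ᵐ[volume] θ₀
  u_zero : u 0 =ᵐ[volume] u₀
  theta_eq : ∀ t ∈ Set.Ioc 0 T, ∀ᵐ x,
    θ t x = heatSemigroup ν α t θ₀ x
      - ∫ s in (0 : ℝ)..t, gradHeat ν α (t - s) (fun y => θ s y • u s y) x
  u_eq : ∀ t ∈ Set.Ioc 0 T, ∀ᵐ x, ∀ i : Fin 2,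
    u t x i = heatSemigroup ν α t (fun y => u₀ y i) x
      - ∫ s in (0 : ℝ)..t, gradHeatK ν α (t - s) i (fun y => θ s y • u s y) x

/-- As an element of `L^∞(ℝ²)`, `f` is a `C^k` function all of whose partial derivatives of order
at most `k` are bounded by `M`. -/
def HasCkBound (k : ℕ) (M : ℝ) (f : Plane → ℝ) : Prop :=
  ∃ F : Plane → ℝ, ContDiff ℝ k F ∧ f =ᵐ[volume] F ∧
    ∀ β : Fin 2 → ℕ, β 0 + β 1 ≤ k → ∀ x, |multiDeriv β F x| ≤ M

end DissipativeSQG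

end

/-! The triple `V = (θ, u₁, u₂)` is treated as one unknown with values in a finite-dimensional
space. It satisfies `V(t) = g(t) * f - ∫₀ᵗ N(t-s) * (V, V)(s) ds`, where `N(τ)` takes values in
bilinear maps and `‖N(τ)‖₁ ≤ C τ^(-γ)` with `γ = 1/(2α) < 1`. The velocity keeps its own equation,
so no singular integral is ever applied to a merely bounded function.

Regularity follows from this structure alone (`IsDuhamelSolution.contDiff`). For a fixed shift `d`,
let `A` be the supremum of `e^(-λt) |V(t, x+d) - V(t, x)|`; it is finite because `V` is bounded.
Subtracting the equation at `x` from the equation at `x + d` gives `A ≤ c|d| + A/2` for large `λ`,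
so `V` is Lipschitz in space (`IsDuhamelSolution.exists_lipschitz`). By Rademacher's theorem `V(s)`
is differentiable almost everywhere, which suffices to differentiate the integrals at every point.
The pair `(V, DV)` then solves an equation of the same form, whose bilinear kernel encodes the
product rule (`IsDuhamelSolution.tangent`). Induction on `k`, over all state spaces at once,
finishes this part.

It remains to bound the kernels. The heat kernel is self-similar and `K` is homogeneous of degree
`-2`, so `∂ⱼg(τ)` and `K * ∂ⱼg(τ)` are dilations of their time-one profiles, and the factor `τ^(-γ)`
is the cost of one derivative. Only integrability at time one is left. For `g` and its derivatives
it comes from `|x|⁻³` decay: the symbol `ξ^β exp(-c|ξ|^(2α))` can be differentiated three times with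
integrable result, since the worst singularity at the origin is of order `2α - 3 > -2`
(`exists_pairFourier_symbolTerm_decay`). For `K * ∂ⱼg`, split `K` into an odd part singular at the
origin and a regular part. The singular part is controlled by the `L¹` modulus of continuity of
`∂ⱼg`; in the regular part the derivative is moved onto the kernel (`pvConvK_partialDeriv`). -/

noncomputable section

set_option linter.unusedSectionVars false

namespace DissipativeSQG

section QuadraticDuhamel

set_option maxSynthPendingDepth 3

variable {X : Type} [NormedAddCommGroup X] [NormedSpace ℝ X] [FiniteDimensional ℝ X]
  [MeasureSpace X] [BorelSpace X] [(volume : Measure X).IsAddHaarMeasure]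

/-! ### Quadratic convolutions with an integrable bilinear kernel -/

section QuadConv

variable {E : Type} [NormedAddCommGroup E] [NormedSpace ℝ E]

/-- The quadratic convolution `∫ κ(z)(v(x - z), v(x - z)) dz` with a kernel of bilinear maps. -/
def quadConv (κ : X → E →L[ℝ] E →L[ℝ] E) (v : X → E) (x : X) : E :=
  ∫ z, κ z (v (x - z)) (v (x - z))

theorem norm_bilin_self_le {b : E →L[ℝ] E →L[ℝ] E} {a : E} {M : ℝ} (ha : ‖a‖ ≤ M) :
    ‖b a a‖ ≤ ‖b‖ * M ^ 2 := by
  have hM : 0 ≤ M := (norm_nonneg a).trans ha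
  calc ‖b a a‖ ≤ ‖b‖ * ‖a‖ * ‖a‖ := b.le_opNorm₂ a a
    _ ≤ ‖b‖ * M * M := by gcongr
    _ = ‖b‖ * M ^ 2 := by ring

theorem norm_bilin_self_sub_le {b : E →L[ℝ] E →L[ℝ] E} {a a' : E} {M δ : ℝ} (ha : ‖a‖ ≤ M)
    (ha' : ‖a'‖ ≤ M) (hδ : ‖a' - a‖ ≤ δ) : ‖b a' a' - b a a‖ ≤ ‖b‖ * (2 * M * δ) := by
  have hM : 0 ≤ M := (norm_nonneg a).trans ha
  have hd : 0 ≤ δ := (norm_nonneg _).trans hδ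
  have e : b a' a' - b a a = b (a' - a) a' + b a (a' - a) := by simp
  rw [e]
  calc ‖b (a' - a) a' + b a (a' - a)‖
      ≤ ‖b‖ * ‖a' - a‖ * ‖a'‖ + ‖b‖ * ‖a‖ * ‖a' - a‖ :=
        (norm_add_le _ _).trans (add_le_add (b.le_opNorm₂ _ _) (b.le_opNorm₂ _ _))
    _ ≤ ‖b‖ * δ * M + ‖b‖ * M * δ := by gcongr
    _ = ‖b‖ * (2 * M * δ) := by ring

theorem continuous_bilin_self :
    Continuous fun p : (E →L[ℝ] E →L[ℝ] E) × E => p.1 p.2 p.2 :=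
  (continuous_fst.clm_apply continuous_snd).clm_apply continuous_snd

theorem stronglyMeasurable_bilin_self {Ω : Type*} [MeasurableSpace Ω]
    {b : Ω → E →L[ℝ] E →L[ℝ] E} {a : Ω → E} (hb : StronglyMeasurable b)
    (ha : StronglyMeasurable a) : StronglyMeasurable fun x => b x (a x) (a x) :=
  continuous_bilin_self.comp_stronglyMeasurable (hb.prodMk ha)

theorem aestronglyMeasurable_bilin_self {Ω : Type*} [MeasurableSpace Ω] {μ : Measure Ω}
    {b : Ω → E →L[ℝ] E →L[ℝ] E} {a : Ω → E} (hb : AEStronglyMeasurable b μ)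
    (ha : AEStronglyMeasurable a μ) : AEStronglyMeasurable (fun x => b x (a x) (a x)) μ :=
  continuous_bilin_self.comp_aestronglyMeasurable (hb.prodMk ha)

variable {κ : X → E →L[ℝ] E →L[ℝ] E} {v : X → E} {M : ℝ}

theorem integrable_quadConv (hκ : Integrable κ) (hv : StronglyMeasurable v)
    (hM : ∀ y, ‖v y‖ ≤ M) (x : X) :
    Integrable fun z => κ z (v (x - z)) (v (x - z)) := by
  refine (hκ.norm.mul_const (M ^ 2)).mono' ?_ (.of_forall fun z => norm_bilin_self_le (hM _))
  exact aestronglyMeasurable_bilin_self hκ.1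
    (hv.comp_measurable (measurable_const.sub measurable_id)).aestronglyMeasurable

theorem norm_quadConv_le (hκ : Integrable κ) (hM : ∀ y, ‖v y‖ ≤ M) (x : X) :
    ‖quadConv κ v x‖ ≤ (∫ z, ‖κ z‖) * M ^ 2 := by
  rw [← integral_mul_const]
  exact norm_integral_le_of_norm_le (hκ.norm.mul_const _)
    (.of_forall fun z => norm_bilin_self_le (hM _))

theorem norm_quadConv_sub_le (hκ : Integrable κ) (hv : StronglyMeasurable v)
    (hM : ∀ y, ‖v y‖ ≤ M) {δ : ℝ} {x x' : X}
    (hδ : ∀ z, ‖v (x' - z) - v (x - z)‖ ≤ δ) :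
    ‖quadConv κ v x' - quadConv κ v x‖ ≤ (∫ z, ‖κ z‖) * (2 * M * δ) := by
  rw [← integral_mul_const, quadConv, quadConv,
    ← integral_sub (integrable_quadConv hκ hv hM x') (integrable_quadConv hκ hv hM x)]
  exact norm_integral_le_of_norm_le (hκ.norm.mul_const _)
    (.of_forall fun z => norm_bilin_self_sub_le (hM _) (hM _) (hδ z))

theorem quadConv_sub_kernel {κ' : X → E →L[ℝ] E →L[ℝ] E} (hκ : Integrable κ)
    (hκ' : Integrable κ') (hv : StronglyMeasurable v) (hM : ∀ y, ‖v y‖ ≤ M) (x : X) :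
    quadConv (fun z => κ z - κ' z) v x = quadConv κ v x - quadConv κ' v x := by
  rw [quadConv, quadConv, quadConv,
    ← integral_sub (integrable_quadConv hκ hv hM x) (integrable_quadConv hκ' hv hM x)]
  simp

theorem quadConv_congr_ae {w : X → E} (h : v =ᵐ[volume] w) (x : X) :
    quadConv κ v x = quadConv κ w x := by
  refine integral_congr_ae ?_
  filter_upwards [(quasiMeasurePreserving_sub_left volume x).ae h] with z hz
  rw [hz]

/-- Although quadratic in `v`, the integrand is linear in `κ z`. The integral is thus an ordinary
convolution of `κ` with the bounded function `y ↦ ev (v y)`, where `ev e` evaluates a bilinear map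
at `(e, e)`. -/
theorem continuous_quadConv_of_hasCompactSupport (hκ : Continuous κ) (hs : HasCompactSupport κ)
    (hv : StronglyMeasurable v) (hM : ∀ y, ‖v y‖ ≤ M) : Continuous (quadConv κ v) := by
  let ev : E → (E →L[ℝ] E →L[ℝ] E) →L[ℝ] E := fun e =>
    (ContinuousLinearMap.apply ℝ E e).comp (ContinuousLinearMap.apply ℝ (E →L[ℝ] E) e)
  have hev : Continuous ev := by
    have h1 : Continuous fun e : E => ContinuousLinearMap.apply ℝ E e :=
      (ContinuousLinearMap.apply ℝ E).continuous
    have h2 : Continuous fun e : E => ContinuousLinearMap.apply ℝ (E →L[ℝ] E) e :=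
      (ContinuousLinearMap.apply ℝ (E →L[ℝ] E)).continuous
    exact h1.clm_comp h2
  have hbd : ∀ y, ‖ev (v y)‖ ≤ M ^ 2 := fun y =>
    ContinuousLinearMap.opNorm_le_bound _ (sq_nonneg M) fun b => by
      rw [mul_comm]; exact norm_bilin_self_le (hM y)
  have hloc : LocallyIntegrable (fun y => ev (v y)) (volume : Measure X) :=
    (memLp_top_of_bound (hev.comp_stronglyMeasurable hv).aestronglyMeasurable (M ^ 2)
      (.of_forall hbd)).locallyIntegrable le_top
  exact hs.continuous_convolution_left
    (ContinuousLinearMap.apply ℝ E : (E →L[ℝ] E →L[ℝ] E) →L[ℝ] _ →L[ℝ] E) hκ hloc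

/-- The convolution of an integrable kernel with a bounded function is continuous. -/
theorem continuous_quadConv (hκ : Integrable κ) (hv : StronglyMeasurable v)
    (hM : ∀ y, ‖v y‖ ≤ M) : Continuous (quadConv κ v) := by
  -- An `L¹` error in the kernel costs at most `M ^ 2` times itself, uniformly in `x`, so density of
  -- compactly supported continuous kernels gives uniform convergence.
  have key : ∀ n : ℕ, ∃ g : X → E →L[ℝ] E →L[ℝ] E, HasCompactSupport g ∧
      ∫ x, ‖κ x - g x‖ ≤ 1 / ((n : ℝ) + 1) ∧ Continuous g ∧ Integrable g := fun n =>
    hκ.exists_hasCompactSupport_integral_sub_le (by positivity)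
  choose g hg1 hg2 hg3 hg4 using key
  have hunif : TendstoUniformly (fun n => quadConv (g n) v) (quadConv κ v) atTop := by
    rw [Metric.tendstoUniformly_iff]
    intro ε hε
    have ht : Tendsto (fun n : ℕ => 1 / ((n : ℝ) + 1) * M ^ 2) atTop (𝓝 0) := by
      simpa using tendsto_one_div_add_atTop_nhds_zero_nat.mul_const (M ^ 2)
    filter_upwards [ht.eventually_lt_const hε] with n hn x
    rw [dist_eq_norm, ← quadConv_sub_kernel hκ (hg4 n) hv hM]
    refine (norm_quadConv_le (hκ.sub (hg4 n)) hM x).trans_lt (lt_of_le_of_lt ?_ hn)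
    exact mul_le_mul_of_nonneg_right (hg2 n) (sq_nonneg M)
  exact hunif.continuous (Frequently.of_forall fun n =>
    continuous_quadConv_of_hasCompactSupport (hg3 n) (hg1 n) hv hM)

end QuadConv

/-! ### The tangent extension of a bilinear map -/

section Extension

variable {E : Type} [NormedAddCommGroup E] [NormedSpace ℝ E]

variable (X) in
/-- The bilinear map on `E × (X →L E)` by which `(v, Dv)` enters the derivative of
`b(v, v)`. -/
def bilinTangent (b : E →L[ℝ] E →L[ℝ] E) :
    (E × (X →L[ℝ] E)) →L[ℝ] (E × (X →L[ℝ] E)) →L[ℝ] (E × (X →L[ℝ] E)) :=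
  (ContinuousLinearMap.compL ℝ (E × (X →L[ℝ] E)) E (E × (X →L[ℝ] E))
      (ContinuousLinearMap.inl ℝ E (X →L[ℝ] E))).comp
    (b.bilinearComp (ContinuousLinearMap.fst ℝ E (X →L[ℝ] E))
      (ContinuousLinearMap.fst ℝ E (X →L[ℝ] E))) +
  (ContinuousLinearMap.compL ℝ (E × (X →L[ℝ] E)) (X →L[ℝ] E) (E × (X →L[ℝ] E))
      (ContinuousLinearMap.inr ℝ E (X →L[ℝ] E))).comp
    ((b.precompR X).bilinearComp (ContinuousLinearMap.fst ℝ E (X →L[ℝ] E))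
      (ContinuousLinearMap.snd ℝ E (X →L[ℝ] E)) +
     (b.precompL X).bilinearComp (ContinuousLinearMap.snd ℝ E (X →L[ℝ] E))
      (ContinuousLinearMap.fst ℝ E (X →L[ℝ] E)))

/-- On the diagonal `p = q = (v, Dv)` the second slot is the product rule for `b(v, v)`, while the
first slot reproduces the original term. The differentiated equation is therefore again quadratic.
-/
theorem bilinTangent_apply (b : E →L[ℝ] E →L[ℝ] E) (p q : E × (X →L[ℝ] E)) :
    bilinTangent X b p q =
      (b p.1 q.1, (b p.1).comp q.2 + (b.flip q.1).comp p.2) := by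
  ext <;> simp [bilinTangent]

variable (X) in
/-- The tangent extension of bilinear maps, as a linear map. -/
def bilinTangentLin : (E →L[ℝ] E →L[ℝ] E) →ₗ[ℝ]
    (E × (X →L[ℝ] E)) →L[ℝ] (E × (X →L[ℝ] E)) →L[ℝ] (E × (X →L[ℝ] E)) where
  toFun := bilinTangent X
  map_add' b c := by
    refine ContinuousLinearMap.ext fun p => ContinuousLinearMap.ext fun q => ?_
    simp only [bilinTangent_apply, add_apply]
    refine Prod.ext rfl ?_
    ext
    simp
    abel
  map_smul' r b := by
    refine ContinuousLinearMap.ext fun p => ContinuousLinearMap.ext fun q => ?_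
    simp only [bilinTangent_apply, smul_apply]
    refine Prod.ext rfl ?_
    ext
    simp

variable [FiniteDimensional ℝ E]

variable (X) in
theorem continuous_bilinTangent : Continuous (bilinTangent X (E := E)) :=
  (bilinTangentLin X (E := E)).continuous_of_finiteDimensional

variable (X E) in
theorem exists_norm_bilinTangent_le : ∃ C : ℝ, 0 ≤ C ∧ ∀ b : E →L[ℝ] E →L[ℝ] E,
    ‖bilinTangent X b‖ ≤ C * ‖b‖ :=
  ⟨‖(bilinTangentLin X (E := E)).toContinuousLinearMap‖,
    ContinuousLinearMap.opNorm_nonneg _, fun b =>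
    (bilinTangentLin X (E := E)).toContinuousLinearMap.le_opNorm b⟩

theorem integrable_bilinTangent {κ : X → E →L[ℝ] E →L[ℝ] E} (hκ : Integrable κ) :
    Integrable fun z => bilinTangent X (κ z) := by
  obtain ⟨C, -, hC⟩ := exists_norm_bilinTangent_le X E
  exact (hκ.norm.const_mul C).mono'
    ((continuous_bilinTangent X).comp_aestronglyMeasurable hκ.1) (.of_forall fun z => hC _)

end Extension

/-! ### Differentiating a quadratic convolution of a Lipschitz function -/

section Differentiability

variable {E : Type} [NormedAddCommGroup E] [NormedSpace ℝ E]

theorem clm_eq_sum_finBasis (A : X →L[ℝ] E) :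
    A = ∑ i, ((Module.finBasis ℝ X).coord i).toContinuousLinearMap.smulRight
      (A (Module.finBasis ℝ X i)) := by
  ext x
  calc A x = A (∑ i, (Module.finBasis ℝ X).repr x i • Module.finBasis ℝ X i) := by
        rw [(Module.finBasis ℝ X).sum_repr x]
    _ = _ := by
        rw [map_sum]
        simp

/-- Each `F' a e` is a pointwise limit of difference quotients along `e / n`, and an operator on a
finite-dimensional space is recovered from its values on a basis. -/
theorem stronglyMeasurable_of_hasFDerivAt {Ω : Type*} [MeasurableSpace Ω] {F : X → Ω → E}
    {F' : Ω → X →L[ℝ] E} {x₀ : X} (hF : ∀ h, StronglyMeasurable (F h))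
    (hd : ∀ a, HasFDerivAt (F · a) (F' a) x₀) : StronglyMeasurable F' := by
  have h1 : ∀ e : X, StronglyMeasurable fun a => F' a e := by
    intro e
    refine stronglyMeasurable_of_tendsto atTop
      (f := fun (n : ℕ) a => (n : ℝ) • (F (x₀ + (n : ℝ)⁻¹ • e) a - F x₀ a))
      (fun n => ((hF _).sub (hF _)).const_smul _) ?_
    rw [tendsto_pi_nhds]
    intro a
    exact ((hd a).lim_real e).comp tendsto_natCast_atTop_atTop
  rw [show F' = fun a => _ from funext fun a => clm_eq_sum_finBasis (F' a)]
  refine Finset.stronglyMeasurable_fun_sum _ fun i _ => ?_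
  exact (ContinuousLinearMap.smulRightL ℝ X E
    ((Module.finBasis ℝ X).coord i).toContinuousLinearMap).continuous.comp_stronglyMeasurable (h1 _)

variable [FiniteDimensional ℝ E]

theorem stronglyMeasurable_fderiv_of_finiteDimensional (v : X → E) : StronglyMeasurable (fderiv ℝ v) := by
  have := FiniteDimensional.complete ℝ E
  have : ProperSpace (X →L[ℝ] E) := FiniteDimensional.proper_real _
  exact (measurable_fderiv ℝ v).stronglyMeasurable

/-- By Rademacher, for each fixed `x` the map `v` is differentiable at `x - z` for almost every `z`.
Since the integrands are Lipschitz with integrable constants `‖κ z‖ * (2 * M * L)`, one may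
differentiate under the integral at every `x`. -/
theorem hasFDerivAt_quadConv {κ : X → E →L[ℝ] E →L[ℝ] E} {v : X → E} {M : ℝ}
    {L : NNReal} (hκ : Integrable κ) (hM : ∀ y, ‖v y‖ ≤ M) (hL : LipschitzWith L v)
    (x : X) :
    HasFDerivAt (quadConv κ v)
      (quadConv (fun z => bilinTangent X (κ z)) (fun y => (v y, fderiv ℝ v y)) x).2 x := by
  have := FiniteDimensional.complete ℝ E
  have hM0 : 0 ≤ M := (norm_nonneg _).trans (hM 0)
  have hv : StronglyMeasurable v := hL.continuous.stronglyMeasurable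
  have hw : StronglyMeasurable fun y => (v y, fderiv ℝ v y) :=
    hv.prodMk (stronglyMeasurable_fderiv_of_finiteDimensional v)
  -- Where `v` is not differentiable `fderiv` is zero, so the bound holds everywhere.
  have hwM : ∀ y, ‖(v y, fderiv ℝ v y)‖ ≤ max M L := fun y =>
    max_le_max (hM y) (norm_fderiv_le_of_lipschitz ℝ hL)
  have hint := integrable_quadConv (integrable_bilinTangent hκ) hw hwM x
  let F' : X → X →L[ℝ] E := fun z => (bilinTangent X (κ z) (v (x - z), fderiv ℝ v (x - z))
    (v (x - z), fderiv ℝ v (x - z))).2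
  have hF' : AEStronglyMeasurable F' volume := hint.snd.1
  have hlip : ∀ᵐ z, LipschitzOnWith (Real.nnabs (‖κ z‖ * (2 * M * L)))
      (fun x => κ z (v (x - z)) (v (x - z))) Set.univ := by
    refine .of_forall fun z => LipschitzOnWith.of_dist_le_mul fun p _ q _ => ?_
    rw [dist_eq_norm, Real.coe_nnabs, abs_of_nonneg (by positivity)]
    refine (norm_bilin_self_sub_le (δ := L * dist p q) (hM _) (hM _) ?_).trans_eq (by ring)
    rw [← dist_eq_norm]
    refine (hL.dist_le_mul _ _).trans_eq ?_
    rw [dist_sub_right]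
  have hd : ∀ᵐ z, HasFDerivAt (fun x => κ z (v (x - z)) (v (x - z))) (F' z) x := by
    have hdiff : ∀ᵐ y : X, DifferentiableAt ℝ v y := hL.ae_differentiableAt
    filter_upwards [(quasiMeasurePreserving_sub_left volume x).ae hdiff] with z hz
    have h1 : HasFDerivAt (fun x => v (x - z)) (fderiv ℝ v (x - z)) x := by
      simpa [Function.comp_def] using hz.hasFDerivAt.comp x ((hasFDerivAt_id x).sub_const z)
    have h2 := ((κ z).hasFDerivAt.comp x h1).clm_apply h1
    simp only [F', bilinTangent_apply]
    exact h2
  have hsnd : (quadConv (fun z => bilinTangent X (κ z)) (fun y => (v y, fderiv ℝ v y)) x).2 =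
      ∫ z, F' z := snd_integral hint
  rw [hsnd]
  exact (hasFDerivAt_integral_of_dominated_loc_of_lip (𝕜 := ℝ) (μ := volume) (x₀ := x)
    (s := Set.univ) (F := fun x z => κ z (v (x - z)) (v (x - z)))
    (bound := fun z => ‖κ z‖ * (2 * M * L)) Filter.univ_mem
    (.of_forall fun x' => (integrable_quadConv hκ hv hM x').1)
    (integrable_quadConv hκ hv hM x) hF' hlip (hκ.norm.mul_const _) hd).2

end Differentiability

/-! ### Convolution of a scalar kernel with the initial datum -/

section SmulConv

variable {E : Type} [NormedAddCommGroup E] [NormedSpace ℝ E]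

/-- The convolution `∫ g(z) f(x - z) dz` of a scalar kernel with a vector-valued function. -/
def smulConv (g : X → ℝ) (f : X → E) (x : X) : E := ∫ z, g z • f (x - z)

variable {g : X → ℝ} {f : X → E} {M : ℝ}

theorem integrable_smulConv (hg : Integrable g) (hf : Continuous f) (hM : ∀ y, ‖f y‖ ≤ M)
    (x : X) : Integrable fun z => g z • f (x - z) := by
  refine (hg.norm.mul_const M).mono' ?_ (.of_forall fun z => ?_)
  · exact hg.1.smul (hf.comp (continuous_const.sub continuous_id)).aestronglyMeasurable
  · rw [norm_smul]
    exact mul_le_mul_of_nonneg_left (hM _) (norm_nonneg _)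

theorem norm_smulConv_le (hg : Integrable g) (hM : ∀ y, ‖f y‖ ≤ M) (x : X) :
    ‖smulConv g f x‖ ≤ (∫ z, ‖g z‖) * M := by
  rw [← integral_mul_const]
  refine norm_integral_le_of_norm_le (hg.norm.mul_const _) (.of_forall fun z => ?_)
  rw [norm_smul]
  exact mul_le_mul_of_nonneg_left (hM _) (norm_nonneg _)

theorem norm_smulConv_sub_le (hg : Integrable g) (hf : Continuous f) (hM : ∀ y, ‖f y‖ ≤ M)
    {δ : ℝ} {x x' : X} (hδ : ∀ z, ‖f (x' - z) - f (x - z)‖ ≤ δ) :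
    ‖smulConv g f x' - smulConv g f x‖ ≤ (∫ z, ‖g z‖) * δ := by
  rw [← integral_mul_const, smulConv, smulConv,
    ← integral_sub (integrable_smulConv hg hf hM x') (integrable_smulConv hg hf hM x)]
  refine norm_integral_le_of_norm_le (hg.norm.mul_const _) (.of_forall fun z => ?_)
  rw [← smul_sub, norm_smul]
  exact mul_le_mul_of_nonneg_left (hδ _) (norm_nonneg _)

theorem continuous_smulConv (hg : Integrable g) (hf : Continuous f) (hM : ∀ y, ‖f y‖ ≤ M) :
    Continuous (smulConv g f) := by
  refine continuous_of_dominated (bound := fun z => ‖g z‖ * M)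
    (fun x => (integrable_smulConv hg hf hM x).1) (fun x => .of_forall fun z => ?_)
    (hg.norm.mul_const _) (.of_forall fun z => ?_)
  · rw [norm_smul]
    exact mul_le_mul_of_nonneg_left (hM _) (norm_nonneg _)
  · exact continuous_const.smul (hf.comp (continuous_id.sub continuous_const))

theorem hasFDerivAt_smulConv [CompleteSpace E] {L : ℝ} (hg : Integrable g)
    (hf : ContDiff ℝ 1 f) (hM : ∀ y, ‖f y‖ ≤ M) (hL : ∀ y, ‖fderiv ℝ f y‖ ≤ L) (x : X) :
    HasFDerivAt (smulConv g f) (smulConv g (fderiv ℝ f) x) x := by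
  have hc : Continuous (fderiv ℝ f) := hf.continuous_fderiv one_ne_zero
  have hL0 : 0 ≤ L := (norm_nonneg _).trans (hL 0)
  refine hasFDerivAt_integral_of_dominated_of_fderiv_le (s := Set.univ)
    (F := fun x z => g z • f (x - z)) (F' := fun x z => g z • fderiv ℝ f (x - z))
    (bound := fun z => ‖g z‖ * L) Filter.univ_mem
    (.of_forall fun x' => (integrable_smulConv hg hf.continuous hM x').1)
    (integrable_smulConv hg hf.continuous hM x) (integrable_smulConv hg hc hL x).1
    (.of_forall fun z y _ => ?_) (hg.norm.mul_const _) (.of_forall fun z y _ => ?_)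
  · rw [norm_smul]
    exact mul_le_mul_of_nonneg_left (hL _) (norm_nonneg _)
  · have h1 : HasFDerivAt (fun x => f (x - z)) (fderiv ℝ f (y - z)) y := by
      simpa [Function.comp_def] using ((hf.differentiable one_ne_zero (y - z)).hasFDerivAt).comp y
        ((hasFDerivAt_id y).sub_const z)
    exact h1.const_smul (g z)

end SmulConv

/-! ### Weakly singular integrals in time -/

section TimeWeights

theorem integrableOn_Ioo_comp_sub_left {F : Type*} [NormedAddCommGroup F] {φ : ℝ → F} {t : ℝ}
    (h : IntegrableOn φ (Set.Ioo 0 t)) : IntegrableOn (fun s => φ (t - s)) (Set.Ioo 0 t) := by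
  rw [← integrable_indicator_iff measurableSet_Ioo] at h ⊢
  refine (h.comp_sub_left t).congr (.of_forall fun s => ?_)
  simp only
  by_cases hs : s ∈ Set.Ioo 0 t
  · rw [Set.indicator_of_mem hs,
      Set.indicator_of_mem (show t - s ∈ Set.Ioo 0 t by constructor <;> linarith [hs.1, hs.2])]
  · rw [Set.indicator_of_notMem hs,
      Set.indicator_of_notMem (fun h' => hs (by constructor <;> linarith [h'.1, h'.2]))]

theorem setIntegral_Ioo_comp_sub_left {F : Type*} [NormedAddCommGroup F] [NormedSpace ℝ F]
    (φ : ℝ → F) (t : ℝ) : ∫ s in Set.Ioo 0 t, φ (t - s) = ∫ s in Set.Ioo 0 t, φ s := by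
  rw [← integral_indicator measurableSet_Ioo, ← integral_indicator measurableSet_Ioo,
    ← integral_sub_left_eq_self (Set.indicator (Set.Ioo 0 t) φ) volume t]
  refine integral_congr_ae (.of_forall fun s => ?_)
  by_cases hs : s ∈ Set.Ioo 0 t
  · simp only [Set.indicator_of_mem hs,
      Set.indicator_of_mem (show t - s ∈ Set.Ioo 0 t by constructor <;> linarith [hs.1, hs.2])]
  · simp only [Set.indicator_of_notMem hs]
    rw [Set.indicator_of_notMem (fun h' => hs (by constructor <;> linarith [h'.1, h'.2]))]

theorem integrableOn_sub_rpow_neg {γ : ℝ} (hγ : γ < 1) (t : ℝ) :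
    IntegrableOn (fun s : ℝ => (t - s) ^ (-γ)) (Set.Ioo 0 t) := by
  rcases le_or_gt t 0 with ht | ht
  · simp [Set.Ioo_eq_empty (not_lt.2 ht)]
  · have h := (intervalIntegral.intervalIntegrable_rpow' (a := 0) (b := t)
      (show -1 < -γ by linarith)).1
    exact integrableOn_Ioo_comp_sub_left (h.mono_set Set.Ioo_subset_Ioc_self)

theorem setIntegral_sub_rpow_neg {γ : ℝ} (hγ : γ < 1) {t T : ℝ} (ht : 0 < t) (htT : t ≤ T) :
    ∫ s in Set.Ioo 0 t, (t - s) ^ (-γ) ≤ T ^ (1 - γ) / (1 - γ) := by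
  rw [setIntegral_Ioo_comp_sub_left (fun s => s ^ (-γ)), ← integral_Ioc_eq_integral_Ioo,
    ← intervalIntegral.integral_of_le ht.le, integral_rpow (Or.inl (by linarith)),
    Real.zero_rpow (by linarith), sub_zero, show -γ + 1 = 1 - γ by ring]
  have : 0 < 1 - γ := by linarith
  gcongr

theorem integrableOn_rpow_mul_exp {γ lam : ℝ} (hγ : γ < 1) (hl : 0 < lam) :
    IntegrableOn (fun s : ℝ => s ^ (-γ) * Real.exp (-(lam * s))) (Set.Ioi 0) := by
  have := integrableOn_rpow_mul_exp_neg_mul_rpow (s := -γ) (p := 1) (b := lam) (by linarith)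
    one_pos hl
  simpa [neg_mul] using this

/-- An exponential weight makes the Volterra operator with kernel `B (t - s)^(-γ)` a
contraction. -/
theorem exists_exp_weight {γ : ℝ} (hγ : γ < 1) {B : ℝ} (hB : 0 ≤ B) :
    ∃ lam : ℝ, 0 < lam ∧ ∀ t : ℝ,
      IntegrableOn (fun s => (t - s) ^ (-γ) * Real.exp (lam * s)) (Set.Ioo 0 t) ∧
      B * ∫ s in Set.Ioo 0 t, (t - s) ^ (-γ) * Real.exp (lam * s) ≤
        1 / 2 * Real.exp (lam * t) := by
  have h1 : 0 < 1 - γ := by linarith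
  -- After reflecting `s ↦ t - s`, the integral is at most `e^(λt)` times the Gamma integral
  -- `λ^(γ-1) Γ(1-γ)`, which is small for large `λ`.
  have hlim : Tendsto (fun lam : ℝ => B * ((1 / lam) ^ (1 - γ) * Real.Gamma (1 - γ))) atTop
      (𝓝 0) := by
    have h2 : Tendsto (fun lam : ℝ => (1 / lam) ^ (1 - γ)) atTop (𝓝 0) := by
      have := (tendsto_inv_atTop_zero (𝕜 := ℝ)).rpow_const (p := 1 - γ) (Or.inr h1.le)
      simpa [Real.zero_rpow h1.ne'] using this
    simpa using (h2.mul_const (Real.Gamma (1 - γ))).const_mul B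
  obtain ⟨lam, hl1, hl⟩ := ((hlim.eventually_lt_const (show (0 : ℝ) < 1 / 2 by norm_num)).and
    (eventually_gt_atTop 0)).exists
  refine ⟨lam, hl, fun t => ?_⟩
  have hfun : (fun s => (t - s) ^ (-γ) * Real.exp (lam * s)) =
      fun s => Real.exp (lam * t) * ((t - s) ^ (-γ) * Real.exp (-(lam * (t - s)))) := by
    funext s
    rw [mul_left_comm, ← Real.exp_add]
    ring_nf
  have hi := integrableOn_rpow_mul_exp hγ hl
  constructor
  · rw [hfun]
    exact (integrableOn_Ioo_comp_sub_left (t := t)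
      (hi.mono_set Set.Ioo_subset_Ioi_self)).const_mul _
  · rw [hfun, integral_const_mul,
      setIntegral_Ioo_comp_sub_left (fun s => s ^ (-γ) * Real.exp (-(lam * s)))]
    have hle : ∫ s in Set.Ioo 0 t, s ^ (-γ) * Real.exp (-(lam * s)) ≤
        (1 / lam) ^ (1 - γ) * Real.Gamma (1 - γ) := by
      rw [← Real.integral_rpow_mul_exp_neg_mul_Ioi h1 hl, show 1 - γ - 1 = -γ by ring]
      refine setIntegral_mono_set hi ?_ (LE.le.eventuallyLE Set.Ioo_subset_Ioi_self)
      refine (ae_restrict_mem measurableSet_Ioi).mono fun s hs => ?_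
      exact mul_nonneg (Real.rpow_nonneg (le_of_lt hs) _) (Real.exp_nonneg _)
    have he := Real.exp_pos (lam * t)
    nlinarith [mul_le_mul_of_nonneg_left hle hB]

end TimeWeights

/-! ### Kernel families and the abstract Duhamel equation -/

/-- A jointly measurable family of integrable kernels with `‖N τ‖₁ ≤ C τ^(-γ)`. -/
structure IsKernelFamily {A : Type} [NormedAddCommGroup A] (γ C : ℝ) (N : ℝ → X → A) :
    Prop where
  meas : StronglyMeasurable (Function.uncurry N)
  integrable : ∀ τ, 0 < τ → Integrable (N τ)
  bound : ∀ τ, 0 < τ → ∫ z, ‖N τ z‖ ≤ C * τ ^ (-γ)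

theorem IsKernelFamily.nonneg {A : Type} [NormedAddCommGroup A] {γ C : ℝ} {N : ℝ → X → A}
    (hN : IsKernelFamily γ C N) : 0 ≤ C := by
  have h := hN.bound 1 one_pos
  rw [Real.one_rpow, mul_one] at h
  exact (integral_nonneg fun z => norm_nonneg _).trans h

variable {E : Type} [NormedAddCommGroup E] [NormedSpace ℝ E]

theorem IsKernelFamily.bilinTangent [FiniteDimensional ℝ E] {γ C : ℝ}
    {N : ℝ → X → E →L[ℝ] E →L[ℝ] E} (hN : IsKernelFamily γ C N) :
    ∃ C', IsKernelFamily γ C' fun τ z => bilinTangent X (N τ z) := by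
  obtain ⟨D, hD, hb⟩ := exists_norm_bilinTangent_le X E
  refine ⟨D * C, (continuous_bilinTangent X).comp_stronglyMeasurable hN.meas,
    fun τ hτ => integrable_bilinTangent (hN.integrable τ hτ), fun τ hτ => ?_⟩
  calc ∫ z, ‖DissipativeSQG.bilinTangent X (N τ z)‖ ≤ ∫ z, D * ‖N τ z‖ :=
        integral_mono (integrable_bilinTangent (hN.integrable τ hτ)).norm
          ((hN.integrable τ hτ).norm.const_mul D) fun z => hb _
    _ = D * ∫ z, ‖N τ z‖ := integral_const_mul _ _
    _ ≤ D * C * τ ^ (-γ) := by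
        rw [mul_assoc]
        exact mul_le_mul_of_nonneg_left (hN.bound τ hτ) hD

/-- The right-hand side of the Duhamel equation with linear kernel `g`, quadratic kernel `N` and
initial datum `f`. -/
def duhamel (g : ℝ → X → ℝ) (N : ℝ → X → E →L[ℝ] E →L[ℝ] E) (f : X → E) (V : ℝ → X → E)
    (t : ℝ) (x : X) : E :=
  smulConv (g t) f x - ∫ s in Set.Ioo 0 t, quadConv (N (t - s)) (V s) x

/-- `V` is an everywhere defined bounded solution on `(0, T]` of the Duhamel equation,
extended by zero. -/
structure IsDuhamelSolution (g : ℝ → X → ℝ) (N : ℝ → X → E →L[ℝ] E →L[ℝ] E) (f : X → E)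
    (T M : ℝ) (V : ℝ → X → E) : Prop where
  meas : StronglyMeasurable (Function.uncurry V)
  bound : ∀ t x, ‖V t x‖ ≤ M
  zero : ∀ t ∉ Set.Ioc 0 T, V t = 0
  eq : ∀ t ∈ Set.Ioc 0 T, ∀ x, V t x = duhamel g N f V t x

section Estimates

variable {γ C M : ℝ} {N : ℝ → X → E →L[ℝ] E →L[ℝ] E} {V : ℝ → X → E}

theorem stronglyMeasurable_quadConv_family (hN : StronglyMeasurable (Function.uncurry N))
    (hV : StronglyMeasurable (Function.uncurry V)) :
    StronglyMeasurable fun p : ℝ × ℝ × X => quadConv (N (p.1 - p.2.1)) (V p.2.1) p.2.2 := by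
  refine StronglyMeasurable.integral_prod_right (ν := (volume : Measure X))
    (f := fun (p : ℝ × ℝ × X) z => N (p.1 - p.2.1) z (V p.2.1 (p.2.2 - z)) (V p.2.1 (p.2.2 - z)))
    ?_
  have h1 : Measurable fun q : (ℝ × ℝ × X) × X => (q.1.1 - q.1.2.1, q.2) := by fun_prop
  have h2 : Measurable fun q : (ℝ × ℝ × X) × X => (q.1.2.1, q.1.2.2 - q.2) := by fun_prop
  exact stronglyMeasurable_bilin_self (hN.comp_measurable h1) (hV.comp_measurable h2)

theorem stronglyMeasurable_quadConv_time (hN : StronglyMeasurable (Function.uncurry N))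
    (hV : StronglyMeasurable (Function.uncurry V)) (t : ℝ) (x : X) :
    StronglyMeasurable fun s => quadConv (N (t - s)) (V s) x :=
  (stronglyMeasurable_quadConv_family hN hV).comp_measurable
    (measurable_const.prodMk (measurable_id.prodMk measurable_const))

theorem stronglyMeasurable_slice (hV : StronglyMeasurable (Function.uncurry V)) (s : ℝ) :
    StronglyMeasurable (V s) :=
  hV.comp_measurable measurable_prodMk_left

theorem norm_quadConv_family_le (hN : IsKernelFamily γ C N) (hM : ∀ t x, ‖V t x‖ ≤ M)
    {t s : ℝ} (hs : s ∈ Set.Ioo 0 t) (x : X) :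
    ‖quadConv (N (t - s)) (V s) x‖ ≤ (t - s) ^ (-γ) * (C * M ^ 2) := by
  have hts : 0 < t - s := sub_pos.2 hs.2
  refine (norm_quadConv_le (hN.integrable _ hts) (hM s) x).trans ?_
  calc (∫ z, ‖N (t - s) z‖) * M ^ 2 ≤ (C * (t - s) ^ (-γ)) * M ^ 2 :=
        mul_le_mul_of_nonneg_right (hN.bound _ hts) (sq_nonneg M)
    _ = _ := by ring

theorem integrableOn_quadConv_family (hγ : γ < 1) (hN : IsKernelFamily γ C N)
    (hV : StronglyMeasurable (Function.uncurry V)) (hM : ∀ t x, ‖V t x‖ ≤ M) (t : ℝ) (x : X) :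
    IntegrableOn (fun s => quadConv (N (t - s)) (V s) x) (Set.Ioo 0 t) := by
  refine ((integrableOn_sub_rpow_neg hγ t).mul_const (C * M ^ 2)).mono'
    (stronglyMeasurable_quadConv_time hN.meas hV t x).aestronglyMeasurable ?_
  exact (ae_restrict_mem measurableSet_Ioo).mono fun s hs => norm_quadConv_family_le hN hM hs x

theorem norm_duhamel_le {g : ℝ → X → ℝ} {f : X → E} {Cg Mf T : ℝ} (hγ : γ < 1)
    (hg : IsKernelFamily 0 Cg g) (hN : IsKernelFamily γ C N)
    (hf : ∀ y, ‖f y‖ ≤ Mf) (hM : ∀ t x, ‖V t x‖ ≤ M) {t : ℝ} (ht : t ∈ Set.Ioc 0 T) (x : X) :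
    ‖duhamel g N f V t x‖ ≤ Cg * Mf + T ^ (1 - γ) / (1 - γ) * (C * M ^ 2) := by
  refine (norm_sub_le _ _).trans (add_le_add ?_ ?_)
  · refine (norm_smulConv_le (hg.integrable t ht.1) hf x).trans ?_
    refine mul_le_mul_of_nonneg_right ?_ ((norm_nonneg _).trans (hf 0))
    simpa using hg.bound t ht.1
  · refine (norm_integral_le_of_norm_le
      ((integrableOn_sub_rpow_neg hγ t).mul_const (C * M ^ 2))
      ((ae_restrict_mem measurableSet_Ioo).mono fun s hs =>
        norm_quadConv_family_le hN hM hs x)).trans ?_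
    rw [integral_mul_const]
    exact mul_le_mul_of_nonneg_right (setIntegral_sub_rpow_neg hγ ht.1 ht.2)
      (mul_nonneg hN.nonneg (sq_nonneg M))

theorem stronglyMeasurable_duhamel {g : ℝ → X → ℝ} {f : X → E}
    (hg : StronglyMeasurable (Function.uncurry g)) (hN : StronglyMeasurable (Function.uncurry N))
    (hf : Continuous f) (hV : StronglyMeasurable (Function.uncurry V)) :
    StronglyMeasurable (Function.uncurry (duhamel g N f V)) := by
  refine StronglyMeasurable.sub ?_ ?_
  · refine StronglyMeasurable.integral_prod_right (ν := (volume : Measure X))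
      (f := fun (p : ℝ × X) z => g p.1 z • f (p.2 - z)) ?_
    have h1 : Measurable fun q : (ℝ × X) × X => (q.1.1, q.2) := by fun_prop
    have h2 : Measurable fun q : (ℝ × X) × X => q.1.2 - q.2 := by fun_prop
    exact (hg.comp_measurable h1).smul (hf.stronglyMeasurable.comp_measurable h2)
  -- The domain `(0, t)` varies with the parameter. Writing it as an indicator jointly in `(t, x,
  -- s)` makes the parametric integral measurable.
  · have h3 : StronglyMeasurable fun q : (ℝ × X) × ℝ => (Set.indicator
        {q : (ℝ × X) × ℝ | q.2 ∈ Set.Ioo 0 q.1.1}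
        (fun q => quadConv (N (q.1.1 - q.2)) (V q.2) q.1.2)) q := by
      refine StronglyMeasurable.indicator ?_ ?_
      · have h4 : Measurable fun q : (ℝ × X) × ℝ => (q.1.1, q.2, q.1.2) := by fun_prop
        exact (stronglyMeasurable_quadConv_family hN hV).comp_measurable h4
      · exact (measurableSet_lt measurable_const measurable_snd).inter
          (measurableSet_lt measurable_snd (measurable_fst.comp measurable_fst))
    have h5 := StronglyMeasurable.integral_prod_right' (ν := (volume : Measure ℝ)) h3
    convert h5 using 1
    funext p
    rw [← integral_indicator measurableSet_Ioo]
    rfl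

theorem continuous_setIntegral_quadConv (hγ : γ < 1) (hN : IsKernelFamily γ C N)
    (hV : StronglyMeasurable (Function.uncurry V)) (hM : ∀ t x, ‖V t x‖ ≤ M) (t : ℝ) :
    Continuous fun x => ∫ s in Set.Ioo 0 t, quadConv (N (t - s)) (V s) x := by
  refine continuous_of_dominated (bound := fun s => (t - s) ^ (-γ) * (C * M ^ 2))
    (fun x => (stronglyMeasurable_quadConv_time hN.meas hV t x).aestronglyMeasurable)
    (fun x => (ae_restrict_mem measurableSet_Ioo).mono fun s hs =>
      norm_quadConv_family_le hN hM hs x)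
    ((integrableOn_sub_rpow_neg hγ t).mul_const _) ?_
  exact (ae_restrict_mem measurableSet_Ioo).mono fun s hs =>
    continuous_quadConv (hN.integrable _ (sub_pos.2 hs.2)) (stronglyMeasurable_slice hV s) (hM s)

end Estimates

/-! ### Continuity and Lipschitz bounds for bounded solutions -/

section Solutions

variable {γ C Cg T M : ℝ} {g : ℝ → X → ℝ} {N : ℝ → X → E →L[ℝ] E →L[ℝ] E} {f : X → E}
  {V : ℝ → X → E}

theorem IsDuhamelSolution.eq_duhamel (h : IsDuhamelSolution g N f T M V) {t : ℝ}
    (ht : t ∈ Set.Ioc 0 T) : V t = duhamel g N f V t :=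
  funext (h.eq t ht)

theorem IsDuhamelSolution.continuous (h : IsDuhamelSolution g N f T M V) (hγ : γ < 1)
    (hg : IsKernelFamily 0 Cg g) (hN : IsKernelFamily γ C N) (hf : Continuous f) {Mf : ℝ}
    (hMf : ∀ y, ‖f y‖ ≤ Mf) (t : ℝ) : Continuous (V t) := by
  by_cases ht : t ∈ Set.Ioc 0 T
  · rw [h.eq_duhamel ht]
    exact (continuous_smulConv (hg.integrable t ht.1) hf hMf).sub
      (continuous_setIntegral_quadConv hγ hN h.meas h.bound t)
  · rw [h.zero t ht]
    exact continuous_zero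

/-- Bounded solutions with Lipschitz data are Lipschitz in space, uniformly in time. -/
theorem IsDuhamelSolution.exists_lipschitz (h : IsDuhamelSolution g N f T M V) (hγ : γ < 1)
    (hg : IsKernelFamily 0 Cg g) (hN : IsKernelFamily γ C N) {Mf : ℝ}
    (hMf : ∀ y, ‖f y‖ ≤ Mf) {L : NNReal} (hL : LipschitzWith L f) :
    ∃ L' : NNReal, ∀ t, LipschitzWith L' (V t) := by
  have hM0 : 0 ≤ M := (norm_nonneg _).trans (h.bound 0 0)
  have hC := hN.nonneg
  have hCg := hg.nonneg
  -- The factor `2 * M` is the Lipschitz constant of `a ↦ b(a, a)` on the ball of radius `M` for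
  -- `‖b‖ ≤ 1`; `C` is the constant of the kernel family.
  obtain ⟨lam, hl, hw⟩ := exists_exp_weight hγ (B := 2 * M * C) (by positivity)
  have main : ∀ t x x', ‖V t x' - V t x‖ ≤
      2 * (Cg * (L * ‖x' - x‖)) * Real.exp (lam * t) := by
    intro t x x'
    set d := x' - x with hd
    -- weighted supremum of the increments in the direction `d`
    let S : Set ℝ := Set.range fun p : ℝ × X =>
      Real.exp (-(lam * p.1)) * ‖V p.1 (p.2 + d) - V p.1 p.2‖
    have hS0 : ∀ p : ℝ × X, 0 ≤ Real.exp (-(lam * p.1)) * ‖V p.1 (p.2 + d) - V p.1 p.2‖ :=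
      fun p => by positivity
    have hSb : BddAbove S := by
      refine ⟨2 * M, ?_⟩
      rintro _ ⟨⟨t, y⟩, rfl⟩
      by_cases ht : t ∈ Set.Ioc 0 T
      · have he : Real.exp (-(lam * t)) ≤ 1 := by
          rw [Real.exp_le_one_iff]
          nlinarith [ht.1]
        calc Real.exp (-(lam * t)) * ‖V t (y + d) - V t y‖
            ≤ 1 * (‖V t (y + d)‖ + ‖V t y‖) :=
              mul_le_mul he (norm_sub_le _ _) (norm_nonneg _) zero_le_one
          _ ≤ 2 * M := by linarith [h.bound t (y + d), h.bound t y]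
      · simp only [h.zero t ht, Pi.zero_apply, sub_self, norm_zero, mul_zero]
        positivity
    set A := sSup S with hA
    have hAle : ∀ s y, ‖V s (y + d) - V s y‖ ≤ A * Real.exp (lam * s) := by
      intro s y
      have h1 : Real.exp (-(lam * s)) * ‖V s (y + d) - V s y‖ ≤ A :=
        le_csSup hSb ⟨(s, y), rfl⟩
      rw [Real.exp_neg, inv_mul_le_iff₀ (Real.exp_pos _)] at h1
      linarith
    have hA0 : 0 ≤ A := (hS0 (0, 0)).trans (le_csSup hSb ⟨(0, 0), rfl⟩)
    -- The term `A / 2` can be absorbed because `hSb` makes `A` a genuine finite supremum; no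
    -- smallness of `T` or of the data is needed.
    have hstep : A ≤ Cg * (L * ‖d‖) + A / 2 := by
      refine csSup_le (Set.range_nonempty _) ?_
      rintro _ ⟨⟨t, y⟩, rfl⟩
      by_cases ht : t ∈ Set.Ioc 0 T
      · simp only
        rw [Real.exp_neg, inv_mul_le_iff₀ (Real.exp_pos _), h.eq t ht, h.eq t ht]
        have e : duhamel g N f V t (y + d) - duhamel g N f V t y =
            (smulConv (g t) f (y + d) - smulConv (g t) f y) -
            ∫ s in Set.Ioo 0 t, (quadConv (N (t - s)) (V s) (y + d) -
              quadConv (N (t - s)) (V s) y) := by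
          rw [integral_sub (integrableOn_quadConv_family hγ hN h.meas h.bound t _)
            (integrableOn_quadConv_family hγ hN h.meas h.bound t _)]
          simp only [duhamel]
          abel
        rw [e]
        have h1 : ‖smulConv (g t) f (y + d) - smulConv (g t) f y‖ ≤ Cg * (L * ‖d‖) := by
          refine (norm_smulConv_sub_le (hg.integrable t ht.1) hL.continuous hMf
            (δ := L * ‖d‖) fun z => ?_).trans ?_
          · refine (hL.norm_sub_le _ _).trans_eq ?_
            congr 2
            abel
          · refine mul_le_mul_of_nonneg_right ?_ (by positivity)
            simpa using hg.bound t ht.1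
        have h2 : ‖∫ s in Set.Ioo 0 t, (quadConv (N (t - s)) (V s) (y + d) -
              quadConv (N (t - s)) (V s) y)‖ ≤ A * (1 / 2 * Real.exp (lam * t)) := by
          have hb : ∀ s ∈ Set.Ioo 0 t, ‖quadConv (N (t - s)) (V s) (y + d) -
              quadConv (N (t - s)) (V s) y‖ ≤
              (2 * M * C * A) * ((t - s) ^ (-γ) * Real.exp (lam * s)) := by
            intro s hs
            have hts : 0 < t - s := sub_pos.2 hs.2
            refine (norm_quadConv_sub_le (hN.integrable _ hts) (stronglyMeasurable_slice h.meas s)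
              (h.bound s) (δ := A * Real.exp (lam * s)) fun z => ?_).trans ?_
            · rw [add_sub_right_comm]
              exact hAle s (y - z)
            · calc (∫ z, ‖N (t - s) z‖) * (2 * M * (A * Real.exp (lam * s)))
                  ≤ (C * (t - s) ^ (-γ)) * (2 * M * (A * Real.exp (lam * s))) :=
                    mul_le_mul_of_nonneg_right (hN.bound _ hts) (by positivity)
                _ = _ := by ring
          refine (norm_integral_le_of_norm_le ((hw t).1.const_mul (2 * M * C * A))
            ((ae_restrict_mem measurableSet_Ioo).mono hb)).trans ?_
          rw [integral_const_mul]
          calc _ = A * (2 * M * C *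
                ∫ s in Set.Ioo 0 t, (t - s) ^ (-γ) * Real.exp (lam * s)) := by ring
            _ ≤ _ := mul_le_mul_of_nonneg_left (hw t).2 hA0
        have h3 : 1 ≤ Real.exp (lam * t) := Real.one_le_exp (mul_nonneg hl.le ht.1.le)
        have h4 : 0 ≤ Cg * (L * ‖d‖) := by positivity
        refine (norm_sub_le _ _).trans ((add_le_add h1 h2).trans ?_)
        nlinarith
      · simp only [h.zero t ht, Pi.zero_apply, sub_self, norm_zero, mul_zero]
        positivity
    have := hAle t x
    rw [hd, add_sub_cancel] at this
    refine this.trans (mul_le_mul_of_nonneg_right ?_ (Real.exp_nonneg _))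
    linarith
  -- Removing the weight costs `e^(λt) ≤ e^(λT)` on `(0, T]`; at all other times `V t = 0`.
  refine ⟨NNReal.mk (2 * (Cg * L) * Real.exp (lam * T)) (by positivity), fun t => ?_⟩
  refine LipschitzWith.of_dist_le_mul fun x' x => ?_
  rw [dist_eq_norm, dist_eq_norm, NNReal.coe_mk]
  by_cases ht : t ∈ Set.Ioc 0 T
  · refine (main t x x').trans ?_
    have h1 : Real.exp (lam * t) ≤ Real.exp (lam * T) :=
      Real.exp_le_exp.2 (mul_le_mul_of_nonneg_left ht.2 hl.le)
    calc _ ≤ 2 * (Cg * (L * ‖x' - x‖)) * Real.exp (lam * T) :=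
          mul_le_mul_of_nonneg_left h1 (by positivity)
      _ = _ := by ring
  · simp only [h.zero t ht, Pi.zero_apply, sub_self, norm_zero]
    positivity

end Solutions

/-! ### The tangent equation and induction on the order of differentiability -/

section Tangent

variable {E : Type} [NormedAddCommGroup E] [NormedSpace ℝ E] [FiniteDimensional ℝ E]

variable {γ C Cg T M : ℝ} {g : ℝ → X → ℝ} {N : ℝ → X → E →L[ℝ] E →L[ℝ] E} {f : X → E}
  {V : ℝ → X → E}

/-- The second exchange of derivative and integral, now in time: the Lipschitz constants in `x` are
bounded by a multiple of `(t - s) ^ (-γ)`, integrable because `γ < 1`. -/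
theorem hasFDerivAt_setIntegral_quadConv (hγ : γ < 1) (hN : IsKernelFamily γ C N)
    (hV : StronglyMeasurable (Function.uncurry V)) (hM : ∀ t x, ‖V t x‖ ≤ M) {L : NNReal}
    (hL : ∀ t, LipschitzWith L (V t)) (t : ℝ) (x : X) :
    HasFDerivAt (fun x => ∫ s in Set.Ioo 0 t, quadConv (N (t - s)) (V s) x)
      (∫ s in Set.Ioo 0 t, (quadConv (fun z => bilinTangent X (N (t - s) z))
        (fun y => (V s y, fderiv ℝ (V s) y)) x).2) x := by
  have hM0 : 0 ≤ M := (norm_nonneg _).trans (hM 0 0)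
  have hC := hN.nonneg
  let F' : ℝ → X →L[ℝ] E := fun s => (quadConv (fun z => bilinTangent X (N (t - s) z))
        (fun y => (V s y, fderiv ℝ (V s) y)) x).2
  have hd : ∀ s ∈ Set.Ioo 0 t,
      HasFDerivAt (fun x => quadConv (N (t - s)) (V s) x) (F' s) x := fun s hs =>
    hasFDerivAt_quadConv (hN.integrable _ (sub_pos.2 hs.2)) (hM s) (hL s) x
  -- The indicator makes the derivative exist for every `s`, as the measurability criterion
  -- requires; for `s` outside `(0, t)` the kernel bounds say nothing.
  have hF' : AEStronglyMeasurable F' (volume.restrict (Set.Ioo 0 t)) := by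
    rw [← aestronglyMeasurable_indicator_iff measurableSet_Ioo]
    refine (stronglyMeasurable_of_hasFDerivAt (x₀ := x)
      (F := fun x s => (Set.Ioo 0 t).indicator (fun s => quadConv (N (t - s)) (V s) x) s)
      (fun h => (stronglyMeasurable_quadConv_time hN.meas hV t h).indicator measurableSet_Ioo)
      fun s => ?_).aestronglyMeasurable
    by_cases hs : s ∈ Set.Ioo 0 t
    · simp only [Set.indicator_of_mem hs]
      exact hd s hs
    · simp only [Set.indicator_of_notMem hs]
      exact hasFDerivAt_const _ _
  have hlip : ∀ᵐ s ∂volume.restrict (Set.Ioo 0 t),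
      LipschitzOnWith (Real.nnabs ((t - s) ^ (-γ) * (C * (2 * M * L))))
        (fun x => quadConv (N (t - s)) (V s) x) Set.univ := by
    refine (ae_restrict_mem measurableSet_Ioo).mono fun s hs => ?_
    have hts : 0 < t - s := sub_pos.2 hs.2
    refine LipschitzOnWith.of_dist_le_mul fun p _ q _ => ?_
    rw [dist_eq_norm, dist_eq_norm, Real.coe_nnabs, abs_of_nonneg (by positivity)]
    refine (norm_quadConv_sub_le (δ := L * ‖p - q‖) (hN.integrable _ hts)
      (stronglyMeasurable_slice hV s) (hM s) fun z => ?_).trans ?_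
    · refine ((hL s).norm_sub_le _ _).trans_eq ?_
      rw [sub_sub_sub_cancel_right]
    · calc (∫ z, ‖N (t - s) z‖) * (2 * M * (L * ‖p - q‖))
          ≤ (C * (t - s) ^ (-γ)) * (2 * M * (L * ‖p - q‖)) :=
            mul_le_mul_of_nonneg_right (hN.bound _ hts) (by positivity)
        _ = _ := by ring
  exact (hasFDerivAt_integral_of_dominated_loc_of_lip (𝕜 := ℝ) (x₀ := x) (s := Set.univ)
    (μ := volume.restrict (Set.Ioo 0 t))
    (F := fun x s => quadConv (N (t - s)) (V s) x)
    (bound := fun s => (t - s) ^ (-γ) * (C * (2 * M * L))) Filter.univ_mem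
    (.of_forall fun x => (integrableOn_quadConv_family hγ hN hV hM t x).1)
    (integrableOn_quadConv_family hγ hN hV hM t x) hF' hlip
    ((integrableOn_sub_rpow_neg hγ t).mul_const _)
    ((ae_restrict_mem measurableSet_Ioo).mono hd)).2

/-- A bounded solution with `C¹_b` data is differentiable in space, and together with its
derivative it solves the tangent Duhamel equation. -/
theorem IsDuhamelSolution.tangent (h : IsDuhamelSolution g N f T M V) (hγ : γ < 1)
    (hg : IsKernelFamily 0 Cg g) (hN : IsKernelFamily γ C N) (hf : ContDiff ℝ 1 f) {Mf Lf : ℝ}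
    (hMf : ∀ y, ‖f y‖ ≤ Mf) (hLf : ∀ y, ‖fderiv ℝ f y‖ ≤ Lf) :
    (∀ t, Differentiable ℝ (V t)) ∧ ∃ M', IsDuhamelSolution g (fun τ z => bilinTangent X (N τ z))
      (fun x => (f x, fderiv ℝ f x)) T M' (fun t x => (V t x, fderiv ℝ (V t) x)) := by
  have := FiniteDimensional.complete ℝ E
  have hf' : Continuous (fderiv ℝ f) := hf.continuous_fderiv one_ne_zero
  have hL : LipschitzWith Lf.toNNReal f :=
    lipschitzWith_of_nnnorm_fderiv_le (hf.differentiable one_ne_zero) fun x => by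
      rw [← NNReal.coe_le_coe, coe_nnnorm]
      exact (hLf x).trans (Real.le_coe_toNNReal _)
  obtain ⟨L, hLV⟩ := h.exists_lipschitz hγ hg hN hMf hL
  have hder : ∀ t ∈ Set.Ioc 0 T, ∀ x, HasFDerivAt (V t) (smulConv (g t) (fderiv ℝ f) x -
      ∫ s in Set.Ioo 0 t, (quadConv (fun z => bilinTangent X (N (t - s) z))
        (fun y => (V s y, fderiv ℝ (V s) y)) x).2) x := by
    intro t ht x
    rw [h.eq_duhamel ht]
    exact (hasFDerivAt_smulConv (hg.integrable t ht.1) hf hMf hLf x).sub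
      (hasFDerivAt_setIntegral_quadConv hγ hN h.meas h.bound hLV t x)
  have hdiff : ∀ t, Differentiable ℝ (V t) := by
    intro t
    by_cases ht : t ∈ Set.Ioc 0 T
    · exact fun x => (hder t ht x).differentiableAt
    · rw [h.zero t ht]
      exact differentiable_const 0
  have hmeas : StronglyMeasurable
      (Function.uncurry fun t x => (V t x, fderiv ℝ (V t) x)) := by
    refine h.meas.prodMk ?_
    -- Differentiating `d ↦ V t (x + d)` at `d = 0`, with `(t, x)` as the parameter, gives joint
    -- measurability of `DV` in time and space.
    refine stronglyMeasurable_of_hasFDerivAt (x₀ := 0)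
      (F := fun (d : X) (p : ℝ × X) => V p.1 (p.2 + d)) (fun d => ?_) fun p => ?_
    · have h1 : Measurable fun p : ℝ × X => (p.1, p.2 + d) := by fun_prop
      exact h.meas.comp_measurable h1
    · have h2 : HasFDerivAt (V p.1) (fderiv ℝ (V p.1) p.2) (p.2 + 0) := by
        rw [add_zero]
        exact (hdiff p.1 p.2).hasFDerivAt
      simpa [Function.comp_def] using h2.comp (0 : X) ((hasFDerivAt_id (0 : X)).const_add p.2)
  have hbound : ∀ t x, ‖(V t x, fderiv ℝ (V t) x)‖ ≤ max M L := fun t x =>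
    max_le_max (h.bound t x) (norm_fderiv_le_of_lipschitz ℝ (hLV t))
  obtain ⟨C', hN'⟩ := hN.bilinTangent
  refine ⟨hdiff, max M L, hmeas, hbound, fun t ht => ?_, fun t ht x => ?_⟩
  · funext x
    simp only [h.zero t ht]
    refine Prod.ext rfl ?_
    exact (hasFDerivAt_const (0 : E) x).fderiv
  · have hfp : Continuous fun x => (f x, fderiv ℝ f x) := hf.continuous.prodMk hf'
    have hfb : ∀ x, ‖(f x, fderiv ℝ f x)‖ ≤ max Mf Lf := fun x => max_le_max (hMf x) (hLf x)
    have hi1 := integrable_smulConv (hg.integrable t ht.1) hfp hfb x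
    have hi2 := integrableOn_quadConv_family hγ hN' hmeas hbound t x
    -- The first component is the original equation; the second is the derivative formula `hder`.
    refine Prod.ext ?_ ?_
    · simp only [duhamel, Prod.fst_sub]
      rw [fst_integral hi2, smulConv, fst_integral hi1, h.eq t ht]
      simp only [duhamel]
      congr 1
      refine setIntegral_congr_fun measurableSet_Ioo fun s hs => ?_
      have hi3 := integrable_quadConv (hN'.integrable _ (sub_pos.2 hs.2))
        (stronglyMeasurable_slice hmeas s) (hbound s) x
      simp only [quadConv]
      rw [fst_integral hi3]
      simp only [bilinTangent_apply]
    · simp only [duhamel, Prod.snd_sub]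
      rw [snd_integral hi2, smulConv, snd_integral hi1, (hder t ht x).fderiv]
      rfl

end Tangent

/-- Propagation of `C^k_b` regularity for bounded solutions of quadratic Duhamel equations. -/
theorem IsDuhamelSolution.contDiff {γ Cg T : ℝ} (hγ : γ < 1) {g : ℝ → X → ℝ}
    (hg : IsKernelFamily 0 Cg g) (k : ℕ) :
    ∀ {E : Type} [NormedAddCommGroup E] [NormedSpace ℝ E] [FiniteDimensional ℝ E] {C M : ℝ}
      {N : ℝ → X → E →L[ℝ] E →L[ℝ] E} {f : X → E} {V : ℝ → X → E},
      IsKernelFamily γ C N → IsDuhamelSolution g N f T M V → ContDiff ℝ k f →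
      (∀ j ≤ k, ∃ B, ∀ x, ‖iteratedFDeriv ℝ j f x‖ ≤ B) →
      (∀ t, ContDiff ℝ k (V t)) ∧ ∀ j ≤ k, ∃ B, ∀ t x, ‖iteratedFDeriv ℝ j (V t) x‖ ≤ B := by
  -- The state space is quantified inside the induction because the step replaces `E` by `E × (X
  -- →L[ℝ] E)` and `V` by `(V, DV)`.
  induction k with
  | zero =>
    intro E _ _ _ C M N f V hN h hf hb
    obtain ⟨Mf, hMf⟩ := hb 0 le_rfl
    refine ⟨fun t => ?_, fun j hj => ⟨M, fun t x => ?_⟩⟩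
    · exact contDiff_zero.2 (h.continuous hγ hg hN hf.continuous
        (fun y => by simpa using hMf y) t)
    · obtain rfl : j = 0 := by lia
      simpa using h.bound t x
  | succ k ih =>
    intro E _ _ _ C M N f V hN h hf hb
    obtain ⟨Mf, hMf⟩ := hb 0 (by lia)
    obtain ⟨Lf, hLf⟩ := hb 1 (by lia)
    have hf1 : ContDiff ℝ 1 f := hf.of_le (by
      push_cast
      exact le_add_self)
    have hfk : ContDiff ℝ k f := hf.of_le (by
      push_cast
      exact le_self_add)
    have hfk' : ContDiff ℝ k (fderiv ℝ f) := by
      refine hf.fderiv_right (m := k) ?_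
      push_cast
      exact le_rfl
    obtain ⟨hdiff, M', hW⟩ := h.tangent hγ hg hN hf1 (fun y => by simpa using hMf y)
      (fun y => by simpa [norm_iteratedFDeriv_one] using hLf y)
    obtain ⟨C', hN'⟩ := hN.bilinTangent
    obtain ⟨h1, h2⟩ := ih hN' hW (hfk.prodMk hfk') (fun j hj => by
      obtain ⟨B₁, hB₁⟩ := hb j (by lia)
      obtain ⟨B₂, hB₂⟩ := hb (j + 1) (by lia)
      refine ⟨max B₁ B₂, fun x => ?_⟩
      rw [iteratedFDeriv_prodMk hfk.contDiffAt hfk'.contDiffAt (by exact_mod_cast hj),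
        ContinuousMultilinearMap.opNorm_prod, norm_iteratedFDeriv_fderiv]
      exact max_le_max (hB₁ x) (hB₂ x))
    refine ⟨fun t => ?_, fun j hj => ?_⟩
    · rw [Nat.cast_succ, contDiff_succ_iff_fderiv]
      exact ⟨hdiff t, by simp, (h1 t).snd⟩
    · rcases j with _ | j
      · exact ⟨M, fun t x => by simpa using h.bound t x⟩
      · obtain ⟨B, hB⟩ := h2 j (by lia)
        refine ⟨B, fun t x => ?_⟩
        rw [← norm_iteratedFDeriv_fderiv]
        refine le_trans ?_ (hB t x)
        have hc := h1 t
        rw [iteratedFDeriv_prodMk (n := k) hc.fst.contDiffAt hc.snd.contDiffAt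
          (by exact_mod_cast (show j ≤ k by lia)), ContinuousMultilinearMap.opNorm_prod]
        exact le_max_right _ _

/-- A bounded function solving the Duhamel equation almost everywhere has an everywhere defined
version. -/
theorem isDuhamelSolution_of_ae {E : Type} [NormedAddCommGroup E] [NormedSpace ℝ E]
    {γ C Cg T M₀ Mf : ℝ} (hγ : γ < 1) {g : ℝ → X → ℝ} {N : ℝ → X → E →L[ℝ] E →L[ℝ] E}
    {f : X → E} {V₀ : ℝ → X → E} (hT : 0 ≤ T)
    (hg : IsKernelFamily 0 Cg g) (hN : IsKernelFamily γ C N) (hf : Continuous f)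
    (hMf : ∀ y, ‖f y‖ ≤ Mf) (hV : StronglyMeasurable (Function.uncurry V₀))
    (hM : ∀ t x, ‖V₀ t x‖ ≤ M₀)
    (h : ∀ᵐ t ∂volume.restrict (Set.Ioc 0 T), V₀ t =ᵐ[volume] duhamel g N f V₀ t) :
    ∃ M, IsDuhamelSolution g N f T M ((Set.Ioc 0 T).indicator (duhamel g N f V₀)) := by
  have hMf0 : 0 ≤ Mf := (norm_nonneg _).trans (hMf 0)
  have hC := hN.nonneg
  have hCg := hg.nonneg
  refine ⟨Cg * Mf + T ^ (1 - γ) / (1 - γ) * (C * M₀ ^ 2), ?_, fun t x => ?_, fun t ht => ?_,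
    fun t ht x => ?_⟩
  · have h1 := (stronglyMeasurable_duhamel hg.meas hN.meas hf hV).indicator
      (measurableSet_Ioc.prod MeasurableSet.univ : MeasurableSet (Set.Ioc (0 : ℝ) T ×ˢ Set.univ))
    convert h1 using 1
    funext p
    by_cases hp : p.1 ∈ Set.Ioc 0 T
    · rw [Set.indicator_of_mem (show p ∈ Set.Ioc 0 T ×ˢ Set.univ from ⟨hp, trivial⟩)]
      simp only [Function.uncurry, Set.indicator_of_mem hp]
    · rw [Set.indicator_of_notMem (fun h' => hp h'.1)]
      simp only [Function.uncurry, Set.indicator_of_notMem hp, Pi.zero_apply]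
  · by_cases ht : t ∈ Set.Ioc 0 T
    · rw [Set.indicator_of_mem ht]
      exact norm_duhamel_le hγ hg hN hMf hM ht x
    · rw [Set.indicator_of_notMem ht, Pi.zero_apply, norm_zero]
      have : 0 < 1 - γ := by linarith
      positivity
  · exact Set.indicator_of_notMem ht _
  -- For almost every time the old and new functions agree almost everywhere in space. The
  -- space-time integrals do not see the difference, so the equation holds at every point.
  · rw [Set.indicator_of_mem ht, duhamel, duhamel]
    congr 1
    refine setIntegral_congr_ae measurableSet_Ioo ?_
    rw [ae_restrict_iff' measurableSet_Ioc] at h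
    filter_upwards [h] with s hs hs'
    have hsT : s ∈ Set.Ioc 0 T := ⟨hs'.1, hs'.2.le.trans ht.2⟩
    rw [Set.indicator_of_mem hsT]
    exact quadConv_congr_ae (hs hsT) x

end QuadraticDuhamel

/-! ### Symbols with a controlled singularity at the origin -/

section SymbolClass

/-- The functions `ζ^l s^p (s² + ζ²)^q exp (-c (s² + ζ²)^α)` of `(s, ζ)`. -/
def symbolTerm (c α : ℝ) (l p : ℕ) (q : ℝ) (z : ℝ × ℝ) : ℝ :=
  z.2 ^ l * z.1 ^ p * (z.1 ^ 2 + z.2 ^ 2) ^ q * Real.exp (-(c * (z.1 ^ 2 + z.2 ^ 2) ^ α))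

/-- Linear combinations of symbol terms that are smooth at the origin or of homogeneity at
least `d` there. -/
def symbolClass (c α d : ℝ) : Submodule ℝ (ℝ × ℝ → ℝ) :=
  Submodule.span ℝ {f | ∃ (l p : ℕ) (q : ℝ), (q = 0 ∨ d ≤ l + p + 2 * q) ∧
    f = symbolTerm c α l p q}

theorem symbolTerm_mem {c α d : ℝ} {l p : ℕ} {q : ℝ} (h : q = 0 ∨ d ≤ l + p + 2 * q) :
    symbolTerm c α l p q ∈ symbolClass c α d :=
  Submodule.subset_span ⟨l, p, q, h, rfl⟩

/-- Off the null line `z.2 = 0`, the base `s² + ζ²` stays positive along the whole horizontal line,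
so its real powers are differentiable there. For `p = 0` the truncated `p - 1` is harmless, its
coefficient being zero. -/
theorem hasDerivAt_symbolTerm (c α : ℝ) (l p : ℕ) (q : ℝ) {z : ℝ × ℝ} (hz : z.2 ≠ 0) :
    HasDerivAt (fun s => symbolTerm c α l p q (s, z.2))
      (p * symbolTerm c α l (p - 1) q z + 2 * q * symbolTerm c α l (p + 1) (q - 1) z
        - 2 * c * α * symbolTerm c α l (p + 1) (q + α - 1) z) z.1 := by
  have hρ : 0 < z.1 ^ 2 + z.2 ^ 2 := by positivity
  have h1 : HasDerivAt (fun s : ℝ => s ^ 2 + z.2 ^ 2) (2 * z.1) z.1 := by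
    simpa using (hasDerivAt_pow 2 z.1).add_const (z.2 ^ 2)
  have h2 := h1.rpow_const (p := q) (Or.inl hρ.ne')
  have h3 := ((h1.rpow_const (p := α) (Or.inl hρ.ne')).const_mul c).neg.exp
  have h4 := (((hasDerivAt_pow p z.1).const_mul (z.2 ^ l)).mul h2).mul h3
  refine h4.congr_deriv ?_
  have e1 : (z.1 ^ 2 + z.2 ^ 2) ^ (q + α - 1) =
      (z.1 ^ 2 + z.2 ^ 2) ^ q * (z.1 ^ 2 + z.2 ^ 2) ^ (α - 1) := by
    rw [← Real.rpow_add hρ]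
    ring_nf
  simp only [symbolTerm, e1, Pi.neg_apply, Pi.mul_apply]
  ring

/-- Differentiation lowers homogeneity by at most one. A term with `q = 0` either stays polynomial
times the exponential, or the exponential is differentiated and the homogeneity is at least `2α -
1`; hence the condition `d ≤ 2 * α`. -/
theorem exists_hasDerivAt_symbolClass {c α d : ℝ} (hα : 0 ≤ α) (hd : d ≤ 2 * α) {f : ℝ × ℝ → ℝ}
    (hf : f ∈ symbolClass c α d) : ∃ f' ∈ symbolClass c α (d - 1), ∀ z : ℝ × ℝ, z.2 ≠ 0 →
      HasDerivAt (fun s => f (s, z.2)) (f' z) z.1 := by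
  induction hf using Submodule.span_induction with
  | mem f hf =>
    obtain ⟨l, p, q, hq, rfl⟩ := hf
    refine ⟨(p : ℝ) • symbolTerm c α l (p - 1) q +
      (2 * q) • symbolTerm c α l (p + 1) (q - 1)
        - (2 * c * α) • symbolTerm c α l (p + 1) (q + α - 1), ?_, fun z hz => ?_⟩
    · refine Submodule.sub_mem _ (Submodule.add_mem _ (Submodule.smul_mem _ _ ?_) ?_)
        (Submodule.smul_mem _ _ ?_)
      · refine symbolTerm_mem (hq.imp_right fun h => ?_)
        have : (p : ℝ) - 1 ≤ ((p - 1 : ℕ) : ℝ) := by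
          rw [sub_le_iff_le_add]
          exact_mod_cast (by lia : p ≤ p - 1 + 1)
        linarith
      · rcases hq with rfl | h
        · simp
        · refine Submodule.smul_mem _ _ (symbolTerm_mem (Or.inr ?_))
          push_cast
          linarith
      · refine symbolTerm_mem (Or.inr ?_)
        have hl : (0 : ℝ) ≤ l := l.cast_nonneg
        have hp : (0 : ℝ) ≤ p := p.cast_nonneg
        push_cast
        rcases hq with rfl | h
        · linarith
        · linarith
    · exact hasDerivAt_symbolTerm c α l p q hz
  | zero => exact ⟨0, Submodule.zero_mem _, fun z _ => hasDerivAt_const _ _⟩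
  | add f g _ _ hf hg =>
    obtain ⟨f', hf', hf⟩ := hf
    obtain ⟨g', hg', hg⟩ := hg
    exact ⟨f' + g', Submodule.add_mem _ hf' hg', fun z hz => (hf z hz).add (hg z hz)⟩
  | smul r f _ hf =>
    obtain ⟨f', hf', hf⟩ := hf
    exact ⟨r • f', Submodule.smul_mem _ _ hf', fun z hz => (hf z hz).const_smul r⟩

/-- The coordinates of the plane as a pair. -/
def planePair (x : Plane) : ℝ × ℝ := (x 0, x 1)

theorem measurePreserving_planePair : MeasurePreserving planePair volume volume :=
  (volume_preserving_finTwoArrow ℝ).comp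
    (EuclideanSpace.volume_preserving_symm_measurableEquiv_toLp (Fin 2))

theorem measurableEmbedding_planePair : MeasurableEmbedding planePair :=
  (MeasurableEquiv.finTwoArrow (α := ℝ)).measurableEmbedding.comp
    (MeasurableEquiv.toLp 2 (Fin 2 → ℝ)).symm.measurableEmbedding

theorem norm_sq_plane (x : Plane) : ‖x‖ ^ 2 = x 0 ^ 2 + x 1 ^ 2 := by
  rw [EuclideanSpace.real_norm_sq_eq, Fin.sum_univ_two]

theorem integrable_norm_rpow_mul_exp {c β D : ℝ} (hc : 0 < c) (hβ : 0 < β) (hD : -2 < D) :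
    Integrable fun x : Plane => ‖x‖ ^ D * Real.exp (-c * ‖x‖ ^ β) := by
  rw [integrable_fun_norm_addHaar volume (f := fun y : ℝ => y ^ D * Real.exp (-c * y ^ β))]
  refine (integrableOn_rpow_mul_exp_neg_mul_rpow (s := D + 1) (by linarith) hβ hc).congr_fun
    (fun y hy => ?_) measurableSet_Ioi
  simp only [finrank_euclideanSpace, Fintype.card_fin, Nat.add_one_sub_one, pow_one, smul_eq_mul]
  rw [Real.rpow_add_one (ne_of_gt hy)]
  ring

theorem measurable_symbolTerm (c α : ℝ) (l p : ℕ) (q : ℝ) :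
    Measurable (symbolTerm c α l p q) := by
  unfold symbolTerm
  fun_prop

/-- The term is dominated by `|x|^(l+p+2q) exp(-c|x|^(2α))`, and `-2` is the critical exponent at
the origin of the plane. -/
theorem integrable_symbolTerm {c α : ℝ} (hc : 0 < c) (hα : 0 < α) {l p : ℕ} {q : ℝ}
    (h : -2 < l + p + 2 * q) : Integrable (symbolTerm c α l p q) := by
  rw [← measurePreserving_planePair.integrable_comp_emb measurableEmbedding_planePair]
  refine (integrable_norm_rpow_mul_exp hc (show 0 < 2 * α by linarith) h).mono'
    ((measurable_symbolTerm c α l p q).comp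
      measurePreserving_planePair.measurable).aestronglyMeasurable ?_
  have h0 : ∀ᵐ x : Plane, x ≠ 0 := by
    simp [ae_iff]
  filter_upwards [h0] with x hx
  have hx' : 0 < ‖x‖ := norm_pos_iff.2 hx
  have e : ∀ r : ℝ, (x 0 ^ 2 + x 1 ^ 2) ^ r = ‖x‖ ^ (2 * r) := fun r => by
    rw [← norm_sq_plane, ← Real.rpow_natCast, ← Real.rpow_mul hx'.le]
    norm_num
  have hle : ∀ i, |x i| ≤ ‖x‖ := fun i => PiLp.norm_apply_le x i
  simp only [Function.comp_apply, planePair, symbolTerm, e, norm_mul, norm_pow, Real.norm_eq_abs,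
    Real.abs_exp]
  rw [abs_of_nonneg (Real.rpow_nonneg hx'.le _), Real.rpow_add hx', Real.rpow_add hx',
    Real.rpow_natCast, Real.rpow_natCast, neg_mul]
  gcongr
  · exact hle 1
  · exact hle 0

theorem integrable_of_mem_symbolClass {c α d : ℝ} (hc : 0 < c) (hα : 0 < α) (hd : -2 < d)
    {f : ℝ × ℝ → ℝ} (hf : f ∈ symbolClass c α d) : Integrable f := by
  induction hf using Submodule.span_induction with
  | mem f hf =>
    obtain ⟨l, p, q, hq, rfl⟩ := hf
    refine integrable_symbolTerm hc hα ?_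
    rcases hq with rfl | h
    · have hl : (0 : ℝ) ≤ l := l.cast_nonneg
      have hp : (0 : ℝ) ≤ p := p.cast_nonneg
      linarith
    · linarith
  | zero => exact integrable_zero _ _ _
  | add f g _ _ hf hg => exact hf.add hg
  | smul r f _ hf => exact hf.smul r

end SymbolClass

/-! ### Fourier decay by integration by parts -/

section FourierPair

/-- The Fourier integral `∫ e^{2πi z·y} f(z) dz` over pairs of reals. -/
def pairFourier (f : ℝ × ℝ → ℝ) (y : ℝ × ℝ) : ℂ :=
  ∫ z : ℝ × ℝ, Complex.exp (2 * Real.pi * (z.1 * y.1 + z.2 * y.2) * Complex.I) * f z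

theorem norm_exp_two_pi_mul_I (r : ℝ) : ‖Complex.exp (2 * Real.pi * r * Complex.I)‖ = 1 := by
  have := Complex.norm_exp_ofReal_mul_I (2 * Real.pi * r)
  push_cast at this
  exact this

theorem norm_pairFourier_kernel (z y : ℝ × ℝ) :
    ‖Complex.exp (2 * Real.pi * (z.1 * y.1 + z.2 * y.2) * Complex.I)‖ = 1 := by
  have := norm_exp_two_pi_mul_I (z.1 * y.1 + z.2 * y.2)
  push_cast at this
  exact this

theorem norm_pairFourier_le (f : ℝ × ℝ → ℝ) (y : ℝ × ℝ) :
    ‖pairFourier f y‖ ≤ ∫ z, |f z| := by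
  refine (norm_integral_le_integral_norm _).trans_eq (integral_congr_ae (.of_forall fun z => ?_))
  simp only [norm_mul, norm_pairFourier_kernel, one_mul, Complex.norm_real, Real.norm_eq_abs]

theorem integrable_pairFourier {f : ℝ × ℝ → ℝ} (hf : Integrable f) (y : ℝ × ℝ) :
    Integrable fun z : ℝ × ℝ =>
      Complex.exp (2 * Real.pi * (z.1 * y.1 + z.2 * y.2) * Complex.I) * f z := by
  refine hf.ofReal.bdd_mul (c := 1) ?_ (.of_forall fun z => (norm_pairFourier_kernel z y).le)
  exact (by fun_prop : Continuous fun z : ℝ × ℝ =>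
    Complex.exp (2 * Real.pi * (z.1 * y.1 + z.2 * y.2) * Complex.I)).aestronglyMeasurable

/-- Integration by parts along almost every horizontal line. Fubini makes the slices of `f` and `f'`
integrable, which also rules out boundary terms. -/
theorem pairFourier_deriv {f f' : ℝ × ℝ → ℝ} (hf : Integrable f) (hf' : Integrable f')
    (hd : ∀ z : ℝ × ℝ, z.2 ≠ 0 → HasDerivAt (fun s => f (s, z.2)) (f' z) z.1) (y : ℝ × ℝ) :
    pairFourier f' y = -(2 * Real.pi * y.1 * Complex.I) * pairFourier f y := by
  have hi := integrable_pairFourier hf y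
  have hi' := integrable_pairFourier hf' y
  rw [pairFourier, pairFourier, Measure.volume_eq_prod, integral_prod_symm _ hi,
    integral_prod_symm _ hi', ← integral_const_mul]
  refine integral_congr_ae ?_
  have hne : ∀ᵐ w : ℝ, w ≠ 0 := by simp [ae_iff]
  filter_upwards [hne, hi.prod_left_ae, hi'.prod_left_ae] with w hw h1 h2
  have hu : ∀ s : ℝ, HasDerivAt
      (fun s : ℝ => Complex.exp (2 * Real.pi * (s * y.1 + w * y.2) * Complex.I))
      (2 * Real.pi * y.1 * Complex.I *
        Complex.exp (2 * Real.pi * (s * y.1 + w * y.2) * Complex.I)) s := by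
    intro s
    have h3 : HasDerivAt (fun s : ℝ => 2 * Real.pi * (s * y.1 + w * y.2) * Complex.I)
        (2 * Real.pi * y.1 * Complex.I) s := by
      have h4 := ((((hasDerivAt_id s).ofReal_comp.mul_const (y.1 : ℂ)).add_const
        ((w : ℂ) * y.2)).const_mul (2 * Real.pi : ℂ)).mul_const Complex.I
      simpa using h4
    simpa [mul_comm] using h3.cexp
  have hv : ∀ s : ℝ, HasDerivAt (fun s : ℝ => ((f (s, w) : ℝ) : ℂ)) (f' (s, w) : ℝ) s :=
    fun s => (hd (s, w) hw).ofReal_comp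
  have key := integral_mul_deriv_eq_deriv_mul_of_integrable (fun s _ => hu s) (fun s _ => hv s)
    h2 (by
      have := h1.const_mul (2 * Real.pi * y.1 * Complex.I)
      refine this.congr (.of_forall fun s => ?_)
      simp only [Pi.mul_apply]
      ring) h1
  rw [key, ← integral_const_mul, ← integral_neg]
  refine integral_congr_ae (.of_forall fun s => ?_)
  simp only
  ring

/-- Three derivatives in the first variable lead from the class of degree `2α` to degree `2α - 3`,
still above `-2` precisely because `α > 1/2`. The third derivative is then integrable and each
derivative contributes a factor `y.1`. -/
theorem exists_pairFourier_symbolTerm_decay {c α : ℝ} (hc : 0 < c) (hα : 1 / 2 < α) (l p : ℕ) :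
    ∃ C : ℝ, ∀ y : ℝ × ℝ, |y.1| ^ 3 * ‖pairFourier (symbolTerm c α l p 0) y‖ ≤ C := by
  have hα0 : 0 < α := by linarith
  have h0 : symbolTerm c α l p 0 ∈ symbolClass c α (2 * α) := symbolTerm_mem (Or.inl rfl)
  obtain ⟨f₁, h1, hd1⟩ := exists_hasDerivAt_symbolClass hα0.le le_rfl h0
  obtain ⟨f₂, h2, hd2⟩ := exists_hasDerivAt_symbolClass hα0.le (by linarith) h1
  obtain ⟨f₃, h3, hd3⟩ := exists_hasDerivAt_symbolClass hα0.le (by linarith) h2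
  have i0 := integrable_of_mem_symbolClass hc hα0 (by linarith) h0
  have i1 := integrable_of_mem_symbolClass hc hα0 (by linarith) h1
  have i2 := integrable_of_mem_symbolClass hc hα0 (by linarith) h2
  have i3 := integrable_of_mem_symbolClass hc hα0 (by linarith) h3
  refine ⟨∫ z, |f₃ z|, fun y => ?_⟩
  have hn : ‖-(2 * Real.pi * y.1 * Complex.I)‖ = 2 * Real.pi * |y.1| := by
    simp [abs_of_pos Real.pi_pos]
  have h := norm_pairFourier_le f₃ y
  rw [pairFourier_deriv i2 i3 hd3, pairFourier_deriv i1 i2 hd2, pairFourier_deriv i0 i1 hd1,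
    norm_mul, norm_mul, norm_mul, hn] at h
  refine le_trans ?_ h
  have hpi : 1 ≤ 2 * Real.pi := by linarith [Real.pi_gt_three]
  have : |y.1| ≤ 2 * Real.pi * |y.1| := le_mul_of_one_le_left (abs_nonneg _) hpi
  calc |y.1| ^ 3 * ‖pairFourier (symbolTerm c α l p 0) y‖
      = |y.1| * (|y.1| * (|y.1| * ‖pairFourier (symbolTerm c α l p 0) y‖)) := by ring
    _ ≤ _ := by gcongr

/-- Transfers decay in the first frequency-dual variable to the second. -/
theorem pairFourier_symbolTerm_swap (c α : ℝ) (l p : ℕ) (y : ℝ × ℝ) :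
    pairFourier (symbolTerm c α l p 0) y = pairFourier (symbolTerm c α p l 0) y.swap := by
  rw [pairFourier, pairFourier, Measure.volume_eq_prod, ← integral_prod_swap]
  refine integral_congr_ae (.of_forall fun z => ?_)
  simp only [symbolTerm, Prod.fst_swap, Prod.snd_swap]
  rw [add_comm (z.2 ^ 2), add_comm ((z.2 : ℂ) * _), mul_comm (z.1 ^ l)]

end FourierPair

/-! ### Derivatives of inverse Fourier transforms on the plane -/

section FourierDerivative

theorem norm_basisVec (i : Fin 2) : ‖basisVec i‖ = 1 := by simp [basisVec]

theorem hasFDerivAt_fourierInv {f : Plane → ℂ} (hf : Integrable f)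
    (hf' : Integrable fun v => ‖v‖ * ‖f v‖) (x : Plane) :
    HasFDerivAt (𝓕⁻ f) (-(𝓕 (VectorFourier.fourierSMulRight (innerSL ℝ) f) (-x))) x := by
  have h1 : 𝓕⁻ f = fun x => 𝓕 f (-x) := funext fun x => Real.fourierInv_eq_fourier_neg f x
  rw [h1]
  have h2 := (Real.hasFDerivAt_fourier hf hf' (-x)).comp x (hasFDerivAt_id x).neg
  refine h2.congr_fderiv ?_
  ext v
  simp

theorem fderiv_fourierInv_basisVec {f : Plane → ℂ} (hf : Integrable f)
    (hf' : Integrable fun v => ‖v‖ * ‖f v‖) (j : Fin 2) (x : Plane) :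
    fderiv ℝ (𝓕⁻ f) x (basisVec j) =
      2 * Real.pi * Complex.I * 𝓕⁻ (fun ξ : Plane => (ξ j : ℂ) * f ξ) x := by
  rw [(hasFDerivAt_fourierInv hf hf' x).fderiv, neg_apply,
    Real.fourier_continuousLinearMap_apply, Real.fourierInv_eq_fourier_neg, Real.fourier_eq,
    Real.fourier_eq, ← integral_const_mul, ← integral_neg]
  · refine integral_congr_ae (.of_forall fun v => ?_)
    have hin : (innerSL ℝ : Plane →L[ℝ] Plane →L[ℝ] ℝ) v (EuclideanSpace.single j 1) = v j := by
      change inner ℝ v (EuclideanSpace.single j 1) = v j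
      simp [EuclideanSpace.inner_single_right]
    simp only [VectorFourier.fourierSMulRight_apply, basisVec, hin, Circle.smul_def, smul_eq_mul,
      Complex.real_smul]
    ring
  · refine (hf'.const_mul (2 * Real.pi)).mono' (hf.1.fourierSMulRight) (.of_forall fun v => ?_)
    refine (VectorFourier.norm_fourierSMulRight_le _ f v).trans ?_
    have h1 : ‖(innerSL ℝ : Plane →L[ℝ] Plane →L[ℝ] ℝ)‖ ≤ 1 := norm_innerSL_le ℝ
    calc _ ≤ 2 * Real.pi * 1 * ‖v‖ * ‖f v‖ := by gcongr
      _ = _ := by ring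

end FourierDerivative

/-! ### Smoothness and cubic decay of the heat kernel at time one -/

section HeatProfile

/-- The symbol `exp (-ν |2πξ|^{2α})` of the fractional heat kernel at time one. -/
def heatSymbol (ν α : ℝ) (ξ : Plane) : ℝ := Real.exp (-(ν * (2 * Real.pi * ‖ξ‖) ^ (2 * α)))

/-- The inverse Fourier transform of `ξ₀^p ξ₁^l exp (-ν |2πξ|^{2α})`. -/
def heatMoment (ν α : ℝ) (p l : ℕ) : Plane → ℂ :=
  𝓕⁻ fun ξ : Plane => ((ξ 0 ^ p * ξ 1 ^ l * heatSymbol ν α ξ : ℝ) : ℂ)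

variable {ν α : ℝ}

theorem heatMoment_integrand_eq (p l : ℕ) (ξ : Plane) :
    ξ 0 ^ p * ξ 1 ^ l * heatSymbol ν α ξ =
      symbolTerm (ν * (2 * Real.pi) ^ (2 * α)) α l p 0 (planePair ξ) := by
  have e : (ξ 0 ^ 2 + ξ 1 ^ 2) ^ α = ‖ξ‖ ^ (2 * α) := by
    rw [← norm_sq_plane, ← Real.rpow_natCast, ← Real.rpow_mul (norm_nonneg _)]
    norm_num
  simp only [heatSymbol, symbolTerm, planePair, Real.rpow_zero, mul_one, e]
  rw [Real.mul_rpow (by positivity) (norm_nonneg _), mul_assoc ν, mul_comm (ξ 0 ^ p)]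

theorem heatMoment_eq_pairFourier (p l : ℕ) (x : Plane) :
    heatMoment ν α p l x =
      pairFourier (symbolTerm (ν * (2 * Real.pi) ^ (2 * α)) α l p 0) (planePair x) := by
  rw [heatMoment, Real.fourierInv_eq', pairFourier,
    ← measurePreserving_planePair.integral_comp measurableEmbedding_planePair]
  refine integral_congr_ae (.of_forall fun ξ => ?_)
  simp only [heatMoment_integrand_eq, smul_eq_mul]
  congr 2
  simp [planePair, PiLp.inner_apply, Fin.sum_univ_two]
  ring_nf

/-- The constant is `3²`, from the power mean inequality for three terms, after `‖x‖ ≤ |x 0| + |x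
1|`. -/
theorem one_add_norm_cube_le (x : Plane) : (1 + ‖x‖) ^ 3 ≤ 9 * (1 + |x 0| ^ 3 + |x 1| ^ 3) := by
  have h : ‖x‖ ≤ |x 0| + |x 1| := by
    refine abs_le_of_sq_le_sq' ?_ (by positivity) |>.2
    rw [norm_sq_plane, ← sq_abs (x 0), ← sq_abs (x 1)]
    nlinarith [abs_nonneg (x 0), abs_nonneg (x 1)]
  have hb := abs_nonneg (x 0)
  have hc := abs_nonneg (x 1)
  generalize |x 0| = b at *
  generalize |x 1| = c at *
  calc (1 + ‖x‖) ^ 3 ≤ (1 + (b + c)) ^ 3 := by gcongr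
    _ ≤ _ := by
      nlinarith [mul_nonneg (by positivity : 0 ≤ 1 + b) (sq_nonneg (1 - b)),
        mul_nonneg (by positivity : 0 ≤ 1 + c) (sq_nonneg (1 - c)),
        mul_nonneg (by positivity : 0 ≤ b + c) (sq_nonneg (b - c)),
        mul_nonneg hb (sq_nonneg (1 - c)), mul_nonneg hc (sq_nonneg (1 - b)), sq_nonneg (b - c)]

theorem integrable_one_add_norm_cube : Integrable fun x : Plane => (1 + ‖x‖) ^ (-3 : ℝ) :=
  integrable_one_add_norm (by
    simp only [finrank_euclideanSpace, Fintype.card_fin]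
    norm_num)

theorem one_add_norm_rpow_neg_three (x : Plane) : (1 + ‖x‖) ^ (-3 : ℝ) = ((1 + ‖x‖) ^ 3)⁻¹ := by
  rw [Real.rpow_neg (by positivity)]
  norm_cast

theorem heat_scale_pos (hν : 0 < ν) : 0 < ν * (2 * Real.pi) ^ (2 * α) :=
  mul_pos hν (Real.rpow_pos_of_pos (by positivity) _)

theorem exists_heatMoment_decay (hν : 0 < ν) (hα : 1 / 2 < α) (p l : ℕ) :
    ∃ C : ℝ, ∀ x, ‖heatMoment ν α p l x‖ ≤ C * (1 + ‖x‖) ^ (-3 : ℝ) := by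
  obtain ⟨C₁, h1⟩ := exists_pairFourier_symbolTerm_decay (heat_scale_pos hν (α := α)) hα l p
  obtain ⟨C₂, h2⟩ := exists_pairFourier_symbolTerm_decay (heat_scale_pos hν (α := α)) hα p l
  refine ⟨9 * ((∫ z, |symbolTerm (ν * (2 * Real.pi) ^ (2 * α)) α l p 0 z|) + C₁ + C₂),
    fun x => ?_⟩
  have h0 := norm_pairFourier_le (symbolTerm (ν * (2 * Real.pi) ^ (2 * α)) α l p 0) (planePair x)
  specialize h1 (planePair x)
  specialize h2 (planePair x).swap
  rw [← pairFourier_symbolTerm_swap] at h2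
  rw [← heatMoment_eq_pairFourier] at h0 h1 h2
  rw [one_add_norm_rpow_neg_three, ← div_eq_mul_inv, le_div_iff₀ (by positivity), mul_comm]
  calc (1 + ‖x‖) ^ 3 * ‖heatMoment ν α p l x‖
      ≤ 9 * (1 + |x 0| ^ 3 + |x 1| ^ 3) * ‖heatMoment ν α p l x‖ := by
        gcongr
        exact one_add_norm_cube_le x
    _ = 9 * (‖heatMoment ν α p l x‖ + |x 0| ^ 3 * ‖heatMoment ν α p l x‖ +
          |x 1| ^ 3 * ‖heatMoment ν α p l x‖) := by ring
    _ ≤ _ := by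
        gcongr
        · exact h1
        · exact h2

theorem integrable_pow_mul_heatMoment_integrand (hν : 0 < ν) (hα : 1 / 2 < α) (p l n : ℕ) :
    Integrable fun ξ : Plane =>
      ‖ξ‖ ^ n * ‖((ξ 0 ^ p * ξ 1 ^ l * heatSymbol ν α ξ : ℝ) : ℂ)‖ := by
  have hα' : 0 < 2 * α := by linarith
  refine (integrable_norm_rpow_mul_exp (heat_scale_pos hν (α := α)) hα'
    (D := ((n + p + l : ℕ) : ℝ)) ?_).mono' ?_ (.of_forall fun ξ => ?_)
  · have : (0 : ℝ) ≤ ((n + p + l : ℕ) : ℝ) := Nat.cast_nonneg _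
    linarith
  · refine Continuous.aestronglyMeasurable ?_
    unfold heatSymbol
    have : Continuous fun ξ : Plane => (2 * Real.pi * ‖ξ‖) ^ (2 * α) :=
      (continuous_const.mul continuous_norm).rpow_const fun _ => Or.inr hα'.le
    fun_prop
  · have hle : ∀ i, |ξ i| ≤ ‖ξ‖ := fun i => PiLp.norm_apply_le ξ i
    simp only [Complex.norm_real, norm_mul, norm_pow, Real.norm_eq_abs, heatSymbol,
      Real.abs_exp, abs_abs, abs_norm]
    rw [Real.mul_rpow (by positivity) (norm_nonneg _), Real.rpow_natCast, pow_add, pow_add,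
      neg_mul, mul_assoc ν, ← mul_assoc, ← mul_assoc]
    gcongr
    · exact hle 0
    · exact hle 1

theorem integrable_heatMoment_integrand (hν : 0 < ν) (hα : 1 / 2 < α) (p l : ℕ) :
    Integrable fun ξ : Plane => ((ξ 0 ^ p * ξ 1 ^ l * heatSymbol ν α ξ : ℝ) : ℂ) := by
  have h := integrable_pow_mul_heatMoment_integrand hν hα p l 0
  simp only [pow_zero, one_mul] at h
  refine (integrable_norm_iff ?_).1 h
  refine Continuous.aestronglyMeasurable ?_
  unfold heatSymbol
  have : Continuous fun ξ : Plane => (2 * Real.pi * ‖ξ‖) ^ (2 * α) :=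
    (continuous_const.mul continuous_norm).rpow_const fun _ => Or.inr (by linarith)
  fun_prop

theorem contDiff_heatMoment (hν : 0 < ν) (hα : 1 / 2 < α) (p l : ℕ) (n : ℕ) :
    ContDiff ℝ n (heatMoment ν α p l) := by
  have h1 : heatMoment ν α p l = fun x =>
      𝓕 (fun ξ : Plane => ((ξ 0 ^ p * ξ 1 ^ l * heatSymbol ν α ξ : ℝ) : ℂ)) (-x) :=
    funext fun x => Real.fourierInv_eq_fourier_neg _ x
  rw [h1]
  have := Real.contDiff_fourier (N := n) fun m _ =>
    integrable_pow_mul_heatMoment_integrand hν hα p l m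
  exact this.comp contDiff_neg

theorem fderiv_heatMoment (hν : 0 < ν) (hα : 1 / 2 < α) (p l : ℕ) (x : Plane) :
    fderiv ℝ (heatMoment ν α p l) x (basisVec 0) =
        2 * Real.pi * Complex.I * heatMoment ν α (p + 1) l x ∧
      fderiv ℝ (heatMoment ν α p l) x (basisVec 1) =
        2 * Real.pi * Complex.I * heatMoment ν α p (l + 1) x := by
  have h := fderiv_fourierInv_basisVec (integrable_heatMoment_integrand hν hα p l)
    (by simpa using integrable_pow_mul_heatMoment_integrand hν hα p l 1)
  constructor
  · rw [heatMoment, h, heatMoment]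
    refine congrArg (fun F : Plane → ℂ => 2 * Real.pi * Complex.I * 𝓕⁻ F x) (funext fun ξ => ?_)
    push_cast
    ring
  · rw [heatMoment, h, heatMoment]
    refine congrArg (fun F : Plane → ℂ => 2 * Real.pi * Complex.I * 𝓕⁻ F x) (funext fun ξ => ?_)
    push_cast
    ring

/-- A function on the plane that decays at infinity like `|x|^{-3}`. -/
def HasCubicDecay (φ : Plane → ℝ) : Prop := ∃ C : ℝ, ∀ x, |φ x| ≤ C * (1 + ‖x‖) ^ (-3 : ℝ)

/-- The real parts of multiples of the functions `heatMoment ν α p l`. -/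
def IsHeatMoment (ν α : ℝ) (φ : Plane → ℝ) : Prop :=
  ∃ (a : ℂ) (p l : ℕ), φ = fun x => (a * heatMoment ν α p l x).re

theorem IsHeatMoment.contDiff (hν : 0 < ν) (hα : 1 / 2 < α) {φ : Plane → ℝ}
    (h : IsHeatMoment ν α φ) (n : ℕ) : ContDiff ℝ n φ := by
  obtain ⟨a, p, l, rfl⟩ := h
  exact Complex.reCLM.contDiff.comp (contDiff_const.mul (contDiff_heatMoment hν hα p l n))

theorem IsHeatMoment.hasCubicDecay (hν : 0 < ν) (hα : 1 / 2 < α) {φ : Plane → ℝ}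
    (h : IsHeatMoment ν α φ) : HasCubicDecay φ := by
  obtain ⟨a, p, l, rfl⟩ := h
  obtain ⟨C, hC⟩ := exists_heatMoment_decay hν hα p l
  refine ⟨‖a‖ * C, fun x => (Complex.abs_re_le_norm _).trans ?_⟩
  rw [norm_mul, mul_assoc]
  exact mul_le_mul_of_nonneg_left (hC x) (norm_nonneg _)

/-- A derivative multiplies the symbol by `2πi ξⱼ`, raising `p` or `l` by one; the complex
coefficient `a` absorbs the factor. Decay and smoothness thus hold for derivatives of the heat
kernel of every order. -/
theorem IsHeatMoment.partialDeriv (hν : 0 < ν) (hα : 1 / 2 < α) {φ : Plane → ℝ}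
    (h : IsHeatMoment ν α φ) (j : Fin 2) : IsHeatMoment ν α (partialDeriv j φ) := by
  obtain ⟨a, p, l, rfl⟩ := h
  have hd : ∀ x v, fderiv ℝ (fun x => (a * heatMoment ν α p l x).re) x v =
      (a * fderiv ℝ (heatMoment ν α p l) x v).re := by
    intro x v
    have h1 : HasFDerivAt (heatMoment ν α p l) (fderiv ℝ (heatMoment ν α p l) x) x :=
      ((contDiff_heatMoment hν hα p l 1).differentiable (by simp) x).hasFDerivAt
    have h2 := Complex.reCLM.hasFDerivAt.comp x (h1.const_mul a)
    have h3 := h2.fderiv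
    simp only [Function.comp_def, Complex.reCLM_apply] at h3
    rw [h3]
    simp
  fin_cases j
  · refine ⟨a * (2 * Real.pi * Complex.I), p + 1, l, funext fun x => ?_⟩
    rw [mul_assoc, ← (fderiv_heatMoment hν hα p l x).1]
    exact hd x _
  · refine ⟨a * (2 * Real.pi * Complex.I), p, l + 1, funext fun x => ?_⟩
    rw [mul_assoc, ← (fderiv_heatMoment hν hα p l x).2]
    exact hd x _

theorem isHeatMoment_heatKernel_one : IsHeatMoment ν α (heatKernel ν α 1) := by
  refine ⟨1, 0, 0, funext fun x => ?_⟩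
  simp [heatKernel, heatMoment, heatSymbol]

theorem HasCubicDecay.integrable {φ : Plane → ℝ} (h : HasCubicDecay φ) (hc : Continuous φ) :
    Integrable φ := by
  obtain ⟨C, hC⟩ := h
  exact (integrable_one_add_norm_cube.const_mul C).mono' hc.aestronglyMeasurable (.of_forall hC)

end HeatProfile

/-! ### Principal value convolution with the kernel `K` -/

section Kernel

/-- The components of the rotation `z ↦ z^⊥ = (-z₂, z₁)`. -/
def rotCoord (i : Fin 2) : Plane →L[ℝ] ℝ :=
  ![-(EuclideanSpace.proj 1 : Plane →L[ℝ] ℝ), EuclideanSpace.proj 0] i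

theorem rotCoord_apply (i : Fin 2) (z : Plane) : rotCoord i z = ![-(z 1), z 0] i := by
  fin_cases i <;> simp [rotCoord]

theorem kernelK_eq (i : Fin 2) (z : Plane) :
    kernelK i z = rotCoord i z / (2 * Real.pi * ‖z‖ ^ 3) := by
  rw [rotCoord_apply, kernelK]

theorem abs_rotCoord_le (i : Fin 2) (z : Plane) : |rotCoord i z| ≤ ‖z‖ := by
  rw [rotCoord_apply]
  have hle : ∀ i, |z i| ≤ ‖z‖ := fun i => PiLp.norm_apply_le z i
  fin_cases i
  · simpa using hle 1
  · simpa using hle 0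

/-- A smooth kernel with the behaviour of `kernelK` at infinity. -/
def regK (i : Fin 2) (z : Plane) : ℝ := rotCoord i z / (2 * Real.pi * (1 + ‖z‖ ^ 3))

/-- The remaining part of `kernelK`, singular at the origin. -/
def singK (i : Fin 2) (z : Plane) : ℝ := kernelK i z - regK i z

theorem abs_kernelK_le (i : Fin 2) {z : Plane} (hz : z ≠ 0) : |kernelK i z| ≤ (‖z‖ ^ 2)⁻¹ := by
  have h : 0 < ‖z‖ := norm_pos_iff.2 hz
  have hp := Real.pi_gt_three
  rw [kernelK_eq, abs_div, abs_of_pos (show 0 < 2 * Real.pi * ‖z‖ ^ 3 by positivity),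
    div_le_iff₀ (by positivity)]
  have e : (‖z‖ ^ 2)⁻¹ * (2 * Real.pi * ‖z‖ ^ 3) = 2 * Real.pi * ‖z‖ := by
    field_simp
  rw [e]
  nlinarith [abs_rotCoord_le i z]

theorem abs_regK_le (i : Fin 2) (z : Plane) : |regK i z| ≤ 1 := by
  have hp := Real.pi_gt_three
  rw [regK, abs_div, abs_of_pos (show 0 < 2 * Real.pi * (1 + ‖z‖ ^ 3) by positivity),
    div_le_one (by positivity)]
  have h1 : ‖z‖ ≤ 1 + ‖z‖ ^ 3 := by
    have := norm_nonneg z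
    rcases le_total ‖z‖ 1 with h | h
    · have : 0 ≤ ‖z‖ ^ 3 := by positivity
      linarith
    · nlinarith [mul_self_nonneg (‖z‖ - 1), mul_nonneg this (mul_self_nonneg (‖z‖ - 1))]
  have h2 : 0 ≤ 1 + ‖z‖ ^ 3 := by positivity
  nlinarith [abs_rotCoord_le i z]

/-- Since `1/r³ - 1/(1+r³) = 1/(r³(1+r³))`, the singular part is of size `r⁻²` at the origin and
`r⁻⁵` at infinity. One extra factor `‖z‖` makes it integrable. -/
theorem abs_singK_mul_norm_le (i : Fin 2) (z : Plane) :
    |singK i z| * ‖z‖ ≤ ‖z‖⁻¹ * (1 + ‖z‖ ^ 3)⁻¹ := by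
  rcases eq_or_ne z 0 with rfl | hz
  · simp
  have h : 0 < ‖z‖ := norm_pos_iff.2 hz
  have hp := Real.pi_gt_three
  have e : singK i z = rotCoord i z / (2 * Real.pi * ‖z‖ ^ 3 * (1 + ‖z‖ ^ 3)) := by
    rw [singK, kernelK_eq, regK]
    field_simp
    ring
  rw [e, abs_div, abs_of_pos (show 0 < 2 * Real.pi * ‖z‖ ^ 3 * (1 + ‖z‖ ^ 3) by positivity),
    div_mul_eq_mul_div, div_le_iff₀ (by positivity)]
  have e2 : ‖z‖⁻¹ * (1 + ‖z‖ ^ 3)⁻¹ * (2 * Real.pi * ‖z‖ ^ 3 * (1 + ‖z‖ ^ 3)) =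
      2 * Real.pi * ‖z‖ * ‖z‖ := by
    field_simp
  rw [e2]
  refine mul_le_mul_of_nonneg_right ?_ h.le
  nlinarith [abs_rotCoord_le i z]

theorem continuous_regK (i : Fin 2) : Continuous (regK i) := by
  unfold regK
  refine (rotCoord i).continuous.div (by fun_prop) fun z => ?_
  positivity

theorem measurable_kernelK (i : Fin 2) : Measurable (kernelK i) := by
  rw [show kernelK i = _ from funext (kernelK_eq i)]
  have := (rotCoord i).continuous.measurable
  fun_prop

theorem measurable_singK (i : Fin 2) : Measurable (singK i) :=
  (measurable_kernelK i).sub (continuous_regK i).measurable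

theorem kernelK_neg (i : Fin 2) (z : Plane) : kernelK i (-z) = -kernelK i z := by
  simp [kernelK_eq, neg_div]

theorem singK_neg (i : Fin 2) (z : Plane) : singK i (-z) = -singK i z := by
  simp [singK, kernelK_neg, regK, neg_div]
  ring

theorem integrable_singK_mul_norm (i : Fin 2) : Integrable fun z => |singK i z| * ‖z‖ := by
  have h1 : Integrable fun z : Plane => ‖z‖⁻¹ * (1 + ‖z‖ ^ 3)⁻¹ := by
    rw [integrable_fun_norm_addHaar volume (f := fun y : ℝ => y⁻¹ * (1 + y ^ 3)⁻¹)]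
    -- In polar coordinates the Jacobian cancels `y⁻¹`; then `1 + y² ≤ 2(1 + y³)`.
    refine ((integrable_inv_one_add_sq.const_mul 2).integrableOn (s := Set.Ioi 0)).mono' ?_ ?_
    · exact Measurable.aestronglyMeasurable (by fun_prop)
    · refine (ae_restrict_mem measurableSet_Ioi).mono fun y (hy : 0 < y) => ?_
      simp only [finrank_euclideanSpace, Fintype.card_fin, Nat.add_one_sub_one, pow_one,
        smul_eq_mul]
      rw [mul_inv_cancel_left₀ hy.ne', Real.norm_of_nonneg (by positivity),
        ← div_eq_mul_inv, inv_eq_one_div, div_le_div_iff₀ (by positivity) (by positivity)]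
      rcases le_total y 1 with h | h
      · nlinarith [pow_pos hy 3]
      · nlinarith [mul_nonneg (sq_nonneg y) (sub_nonneg.2 h)]
  refine h1.mono' ?_ (.of_forall fun z => ?_)
  · exact ((measurable_singK i).abs.mul measurable_norm).aestronglyMeasurable
  · rw [Real.norm_of_nonneg (by positivity)]
    exact abs_singK_mul_norm_le i z

/-- The annulus `ε < |z| < R`. -/
def annulus (p : ℝ × ℝ) : Set Plane := {z | p.1 < ‖z‖ ∧ ‖z‖ < p.2}

theorem measurableSet_annulus (p : ℝ × ℝ) : MeasurableSet (annulus p) :=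
  (measurableSet_lt measurable_const measurable_norm).inter
    (measurableSet_lt measurable_norm measurable_const)

theorem setIntegral_annulus_singK (i : Fin 2) (p : ℝ × ℝ) :
    ∫ z in annulus p, singK i z = 0 := by
  rw [← integral_indicator (measurableSet_annulus p)]
  have h : ∫ z, (annulus p).indicator (singK i) z = -∫ z, (annulus p).indicator (singK i) z := by
    rw [← integral_neg, ← integral_neg_eq_self]
    refine integral_congr_ae (.of_forall fun z => ?_)
    have hm : -z ∈ annulus p ↔ z ∈ annulus p := by simp [annulus]
    by_cases hz : z ∈ annulus p
    · simp only [Set.indicator_of_mem hz, Set.indicator_of_mem (hm.2 hz), singK_neg]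
    · simp only [Set.indicator_of_notMem hz, Set.indicator_of_notMem (fun h => hz (hm.1 h)),
        neg_zero]
  linarith

theorem integrableOn_annulus_singK (i : Fin 2) {p : ℝ × ℝ} (hp : 0 < p.1) :
    IntegrableOn (singK i) (annulus p) := by
  have hfin : volume (annulus p) ≠ ⊤ := by
    refine ((measure_mono fun z hz => ?_).trans_lt
      (measure_ball_lt_top (x := (0 : Plane)) (r := p.2))).ne
    rw [mem_ball_zero_iff]
    exact hz.2
  refine Measure.integrableOn_of_bounded (M := (p.1 ^ 2)⁻¹ + 1) hfin
    (measurable_singK i).aestronglyMeasurable ?_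
  refine (ae_restrict_mem (measurableSet_annulus p)).mono fun z hz => ?_
  have hz0 : 0 < ‖z‖ := hp.trans hz.1
  refine (abs_sub _ _).trans (add_le_add ?_ (abs_regK_le i z))
  refine (abs_kernelK_le i (norm_pos_iff.1 hz0)).trans ?_
  have := hz.1
  gcongr

theorem truncConvK_eq (i : Fin 2) (φ : Plane → ℝ) (x : Plane) (p : ℝ × ℝ) :
    truncConvK i φ x p = ∫ z in annulus p, kernelK i z * φ (x - z) := by
  have hset : MeasurableSet {y : Plane | p.1 < ‖x - y‖ ∧ ‖x - y‖ < p.2} :=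
    (measurable_const.sub measurable_id : Measurable fun y : Plane => x - y)
      (measurableSet_annulus p)
  rw [truncConvK, ← integral_indicator hset, ← integral_indicator (measurableSet_annulus p),
    ← integral_sub_left_eq_self ((annulus p).indicator fun z => kernelK i z * φ (x - z)) volume x]
  refine integral_congr_ae (.of_forall fun y => ?_)
  simp only [Set.indicator, annulus, Set.mem_ofPred_eq, sub_sub_cancel]

/-- The difference part of the principal value integral of `kernelK i` against `φ`. -/
def singPart (i : Fin 2) (φ : Plane → ℝ) (x : Plane) : ℝ :=
  ∫ z, singK i z * (φ (x - z) - φ x)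

/-- The regular part of the principal value integral of `kernelK i` against `φ`. -/
def regPart (i : Fin 2) (φ : Plane → ℝ) (x : Plane) : ℝ := ∫ z, regK i z * φ (x - z)

theorem integrable_singPart_integrand (i : Fin 2) {φ : Plane → ℝ} {L : NNReal}
    (hφ : LipschitzWith L φ) (x : Plane) :
    Integrable fun z => singK i z * (φ (x - z) - φ x) := by
  refine ((integrable_singK_mul_norm i).const_mul L).mono' ?_ (.of_forall fun z => ?_)
  · have : Measurable φ := hφ.continuous.measurable
    have := measurable_singK i
    exact Measurable.aestronglyMeasurable (by fun_prop)
  · have h := hφ.norm_sub_le (x - z) x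
    rw [sub_sub_cancel_left, norm_neg, Real.norm_eq_abs] at h
    rw [norm_mul, Real.norm_eq_abs, Real.norm_eq_abs]
    calc |singK i z| * |φ (x - z) - φ x| ≤ |singK i z| * (L * ‖z‖) := by gcongr
      _ = _ := by ring

theorem integrable_regPart_integrand (i : Fin 2) {φ : Plane → ℝ} (hφ : Integrable φ)
    (x : Plane) : Integrable fun z => regK i z * φ (x - z) :=
  (hφ.comp_sub_left x).bdd_mul (continuous_regK i).aestronglyMeasurable
    (.of_forall (abs_regK_le i))

/-- The singular part is odd, so on every annulus the constant `φ x` may be subtracted at no cost.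
The resulting integrand is absolutely integrable on the plane, and dominated convergence gives the
joint limit. -/
theorem hasPVConvK_of_lipschitz (i : Fin 2) {φ : Plane → ℝ} (hφ : Integrable φ) {L : NNReal}
    (hL : LipschitzWith L φ) (x : Plane) :
    HasPVConvK i φ x (singPart i φ x + regPart i φ x) := by
  have h1 := integrable_singPart_integrand i hL x
  have h2 := integrable_regPart_integrand i hφ x
  have h3 := h1.add h2
  rw [singPart, regPart, ← integral_add h1 h2]
  have hlim : Tendsto (fun p : ℝ × ℝ => ∫ z, (annulus p).indicator
      (fun z => singK i z * (φ (x - z) - φ x) + regK i z * φ (x - z)) z)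
      (𝓝[>] (0 : ℝ) ×ˢ atTop)
      (𝓝 (∫ z, (singK i z * (φ (x - z) - φ x) + regK i z * φ (x - z)))) := by
    refine tendsto_integral_filter_of_dominated_convergence
      (fun z => ‖singK i z * (φ (x - z) - φ x) + regK i z * φ (x - z)‖)
      (.of_forall fun p => h3.1.indicator (measurableSet_annulus p))
      (.of_forall fun p => .of_forall fun z => norm_indicator_le_norm_self _ _) h3.norm ?_
    have h0 : ∀ᵐ z : Plane, z ≠ 0 := by simp [ae_iff]
    filter_upwards [h0] with z hz
    refine tendsto_const_nhds.congr' ?_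
    have e1 : ∀ᶠ ε in 𝓝[>] (0 : ℝ), ε < ‖z‖ :=
      nhdsWithin_le_nhds (eventually_lt_nhds (norm_pos_iff.2 hz))
    have e2 : ∀ᶠ R : ℝ in atTop, ‖z‖ < R := eventually_gt_atTop _
    filter_upwards [e1.prod_mk e2] with p hp
    rw [Set.indicator_of_mem (show z ∈ annulus p from hp)]
  refine hlim.congr' ?_
  have e1 : ∀ᶠ ε in 𝓝[>] (0 : ℝ), 0 < ε := eventually_mem_nhdsWithin
  filter_upwards [e1.prod_inl atTop] with p hp
  rw [truncConvK_eq, integral_indicator (measurableSet_annulus p)]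
  have h4 : Integrable (fun z => singK i z * φ x) (volume.restrict (annulus p)) :=
    (integrableOn_annulus_singK i hp).mul_const _
  have h5 : ∫ z in annulus p, singK i z * φ x = 0 := by
    rw [integral_mul_const, setIntegral_annulus_singK, zero_mul]
  have h6 := integral_add (h3.restrict (s := annulus p)) h4
  rw [h5, add_zero] at h6
  simp only [Pi.add_apply] at h6
  rw [← h6]
  refine integral_congr_ae (.of_forall fun z => ?_)
  simp only [singK]
  ring

/-- By Fubini, the double integral in `x` first is at most `B ∫ |singK i z| ‖z‖ dz`. -/
theorem integrable_singPart (i : Fin 2) {φ : Plane → ℝ} (hφ : Integrable φ)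
    (hc : Continuous φ) {B : ℝ} (hB : ∀ z, ∫ x, |φ (x - z) - φ x| ≤ B * ‖z‖) :
    Integrable (singPart i φ) := by
  have hφm := hc.measurable
  have hKm := measurable_singK i
  have hm : Measurable fun q : Plane × Plane => singK i q.2 * (φ (q.1 - q.2) - φ q.1) := by
    fun_prop
  have hint : Integrable (fun q : Plane × Plane => singK i q.2 * (φ (q.1 - q.2) - φ q.1))
      (volume.prod volume) := by
    rw [integrable_prod_iff' hm.aestronglyMeasurable]
    refine ⟨.of_forall fun z => ((hφ.comp_sub_right z).sub hφ).const_mul (singK i z), ?_⟩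
    refine ((integrable_singK_mul_norm i).const_mul B).mono' ?_ (.of_forall fun z => ?_)
    · exact (hm.norm.stronglyMeasurable.integral_prod_left').aestronglyMeasurable
    · rw [Real.norm_of_nonneg (integral_nonneg fun x => norm_nonneg _)]
      simp only [norm_mul, Real.norm_eq_abs]
      rw [integral_const_mul]
      calc _ ≤ |singK i z| * (B * ‖z‖) := mul_le_mul_of_nonneg_left (hB z) (abs_nonneg _)
        _ = _ := by ring
  exact hint.integral_prod_left

theorem norm_clm_le_sum (A : Plane →L[ℝ] ℝ) : ‖A‖ ≤ |A (basisVec 0)| + |A (basisVec 1)| := by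
  refine A.opNorm_le_bound (by positivity) fun x => ?_
  have hx : x = x 0 • basisVec 0 + x 1 • basisVec 1 := by
    ext j
    fin_cases j <;> simp [basisVec]
  have hle : ∀ i, |x i| ≤ ‖x‖ := fun i => PiLp.norm_apply_le x i
  have e : A x = x 0 * A (basisVec 0) + x 1 * A (basisVec 1) := by
    conv_lhs => rw [hx]
    simp
  rw [e, Real.norm_eq_abs]
  calc |x 0 * A (basisVec 0) + x 1 * A (basisVec 1)|
      ≤ |x 0| * |A (basisVec 0)| + |x 1| * |A (basisVec 1)| := by
        rw [← abs_mul, ← abs_mul]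
        exact abs_add_le _ _
    _ ≤ ‖x‖ * |A (basisVec 0)| + ‖x‖ * |A (basisVec 1)| := by
        gcongr
        · exact hle 0
        · exact hle 1
    _ = _ := by ring

theorem exists_fderiv_decay {φ : Plane → ℝ} (h : ∀ j, HasCubicDecay (partialDeriv j φ)) :
    ∃ C : ℝ, 0 ≤ C ∧ ∀ x, ‖fderiv ℝ φ x‖ ≤ C * (1 + ‖x‖) ^ (-3 : ℝ) := by
  obtain ⟨C₀, h0⟩ := h 0
  obtain ⟨C₁, h1⟩ := h 1
  have hb : ∀ x, ‖fderiv ℝ φ x‖ ≤ (C₀ + C₁) * (1 + ‖x‖) ^ (-3 : ℝ) := fun x => by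
    refine (norm_clm_le_sum _).trans ?_
    rw [add_mul]
    exact add_le_add (h0 x) (h1 x)
  refine ⟨C₀ + C₁, ?_, hb⟩
  have := (norm_nonneg _).trans (hb 0)
  simpa using this

theorem exists_lipschitz_of_decay {φ : Plane → ℝ} (hd : Differentiable ℝ φ)
    (h : ∀ j, HasCubicDecay (partialDeriv j φ)) : ∃ L : NNReal, LipschitzWith L φ := by
  obtain ⟨C, hC, hb⟩ := exists_fderiv_decay h
  refine ⟨C.toNNReal, lipschitzWith_of_nnnorm_fderiv_le hd fun x => ?_⟩
  rw [← NNReal.coe_le_coe, coe_nnnorm, Real.coe_toNNReal C hC]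
  refine (hb x).trans (mul_le_of_le_one_right hC ?_)
  exact Real.rpow_le_one_of_one_le_of_nonpos (by linarith [norm_nonneg x]) (by norm_num)

/-- For `‖z‖ ≤ 1` use the mean value inequality: the weight `(1 + ‖x‖)⁻³` varies by at most `2³ = 8`
over a unit ball. For `‖z‖ ≥ 1` the trivial bound `2‖φ‖₁` is already at most `2‖φ‖₁‖z‖`. -/
theorem exists_integral_translation_le {φ : Plane → ℝ} (hd : Differentiable ℝ φ)
    (hφ : Integrable φ) (h : ∀ j, HasCubicDecay (partialDeriv j φ)) :
    ∃ B : ℝ, ∀ z, ∫ x, |φ (x - z) - φ x| ≤ B * ‖z‖ := by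
  obtain ⟨C, hC, hb⟩ := exists_fderiv_decay h
  set I : ℝ := ∫ x : Plane, (1 + ‖x‖) ^ (-3 : ℝ) with hI
  have hI0 : 0 ≤ I := integral_nonneg fun x => by positivity
  set J : ℝ := ∫ x, |φ x| with hJ
  have hJ0 : 0 ≤ J := integral_nonneg fun x => abs_nonneg _
  refine ⟨8 * C * I + 2 * J, fun z => ?_⟩
  have hint : Integrable fun x => |φ (x - z) - φ x| := ((hφ.comp_sub_right z).sub hφ).abs
  rcases le_total ‖z‖ 1 with hz | hz
  · have hpt : ∀ x, |φ (x - z) - φ x| ≤ 8 * C * ‖z‖ * (1 + ‖x‖) ^ (-3 : ℝ) := by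
      intro x
      have hball : ∀ y ∈ Metric.closedBall x 1,
          ‖fderiv ℝ φ y‖ ≤ 8 * C * (1 + ‖x‖) ^ (-3 : ℝ) := by
        intro y hy
        refine (hb y).trans ?_
        rw [one_add_norm_rpow_neg_three, one_add_norm_rpow_neg_three, mul_comm 8 C, mul_assoc]
        refine mul_le_mul_of_nonneg_left ?_ hC
        rw [← div_eq_mul_inv, inv_eq_one_div, div_le_div_iff₀ (by positivity) (by positivity)]
        have h1 : ‖x‖ ≤ ‖y‖ + 1 := by
          have h2 := norm_sub_norm_le x y
          rw [Metric.mem_closedBall, dist_comm, dist_eq_norm] at hy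
          linarith
        have h3 : 1 + ‖x‖ ≤ 2 * (1 + ‖y‖) := by linarith [norm_nonneg y]
        calc 1 * (1 + ‖x‖) ^ 3 ≤ 1 * (2 * (1 + ‖y‖)) ^ 3 := by gcongr
          _ = _ := by ring
      have hmem : x - z ∈ Metric.closedBall x 1 := by
        rw [Metric.mem_closedBall, dist_eq_norm]
        simpa using hz
      have := (convex_closedBall x 1).norm_image_sub_le_of_norm_fderiv_le (𝕜 := ℝ)
        (fun y _ => hd y) hball (Metric.mem_closedBall_self zero_le_one) hmem
      rw [sub_sub_cancel_left, norm_neg, Real.norm_eq_abs] at this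
      refine this.trans_eq (by ring)
    calc ∫ x, |φ (x - z) - φ x| ≤ ∫ x : Plane, 8 * C * ‖z‖ * (1 + ‖x‖) ^ (-3 : ℝ) :=
          integral_mono hint (integrable_one_add_norm_cube.const_mul _) hpt
      _ = 8 * C * ‖z‖ * I := integral_const_mul _ _
      _ ≤ (8 * C * I + 2 * J) * ‖z‖ := by nlinarith [mul_nonneg hJ0 (norm_nonneg z)]
  · calc ∫ x, |φ (x - z) - φ x| ≤ ∫ x, (|φ (x - z)| + |φ x|) :=
          integral_mono hint ((hφ.comp_sub_right z).abs.add hφ.abs) fun x => abs_sub _ _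
      _ = J + J := by
          rw [integral_add (hφ.comp_sub_right z).abs hφ.abs,
            integral_sub_right_eq_self (fun x => |φ x|) z]
      _ ≤ (8 * C * I + 2 * J) * ‖z‖ := by
          nlinarith [mul_nonneg (mul_nonneg hC hI0) (norm_nonneg z)]

theorem hasFDerivAt_regK (i : Fin 2) (z : Plane) :
    ∃ A : Plane →L[ℝ] ℝ, HasFDerivAt (regK i) A z ∧
      ‖A‖ ≤ 16 * (1 + ‖z‖) ^ (-3 : ℝ) := by
  have hp := Real.pi_gt_three
  have h1 : HasFDerivAt (fun z : Plane => ‖z‖ ^ 3) ((3 * ‖z‖) • innerSL ℝ z) z := by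
    have h := hasFDerivAt_norm_rpow z (p := 3) (by norm_num)
    have e : (3 : ℝ) - 2 = 1 := by norm_num
    rw [e, Real.rpow_one] at h
    exact_mod_cast h
  have h2 : HasFDerivAt (fun z : Plane => 2 * Real.pi * (1 + ‖z‖ ^ 3))
      ((2 * Real.pi) • ((3 * ‖z‖) • innerSL ℝ z)) z := (h1.const_add 1).const_mul _
  have hne : 2 * Real.pi * (1 + ‖z‖ ^ 3) ≠ 0 := by positivity
  have h3 := (rotCoord i).hasFDerivAt (x := z) |>.mul
    ((hasDerivAt_inv hne).comp_hasFDerivAt z h2)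
  refine ⟨_, h3.congr_of_eventuallyEq (.of_forall fun y => by
    simp [regK, div_eq_mul_inv]), ?_⟩
  set r := ‖z‖ with hr
  have hr0 : 0 ≤ r := norm_nonneg z
  have hq : 0 < 1 + r ^ 3 := by positivity
  have hrot : ‖rotCoord i‖ ≤ 1 :=
    (rotCoord i).opNorm_le_bound zero_le_one fun y => by
      rw [one_mul]
      exact abs_rotCoord_le i y
  have hinner : ‖innerSL ℝ z‖ = r := innerSL_apply_norm ℝ z
  have hrz : ‖rotCoord i z‖ ≤ r := abs_rotCoord_le i z
  have hinv : ‖(2 * Real.pi * (1 + r ^ 3))⁻¹‖ ≤ (1 + r ^ 3)⁻¹ := by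
    rw [Real.norm_of_nonneg (by positivity)]
    gcongr
    nlinarith
  have hinv2 : ‖-((2 * Real.pi * (1 + r ^ 3)) ^ 2)⁻¹ * (2 * Real.pi)‖ ≤
      ((1 + r ^ 3) ^ 2)⁻¹ := by
    rw [norm_mul, norm_neg, Real.norm_of_nonneg (by positivity),
      Real.norm_of_nonneg (by positivity), mul_pow, mul_inv, mul_comm, ← mul_assoc]
    refine mul_le_of_le_one_left (by positivity) ?_
    rw [← div_eq_mul_inv, div_le_one (by positivity)]
    nlinarith
  -- The two terms of the quotient rule contribute `3 + 1 = 4`; the other factor `4` is `(1 + r)³ ≤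
  -- 4(1 + r³)`.
  have hmain : (1 + r ^ 3)⁻¹ * 4 ≤ 16 * (1 + r) ^ (-3 : ℝ) := by
    rw [hr, one_add_norm_rpow_neg_three, ← hr, inv_mul_le_iff₀ hq, ← div_eq_mul_inv,
      mul_div_assoc', le_div_iff₀ (by positivity)]
    nlinarith [mul_nonneg (by positivity : 0 ≤ 1 + r) (sq_nonneg (1 - r))]
  refine le_trans ?_ hmain
  have h3r : ‖3 * r‖ = 3 * r := Real.norm_of_nonneg (by positivity)
  have e1 : ‖rotCoord i z • (-((2 * Real.pi * (1 + r ^ 3)) ^ 2)⁻¹ • ((2 * Real.pi) •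
      ((3 * r) • innerSL ℝ z))) + (2 * Real.pi * (1 + r ^ 3))⁻¹ • rotCoord i‖ ≤
      r * (((1 + r ^ 3) ^ 2)⁻¹ * (3 * r * r)) + (1 + r ^ 3)⁻¹ * 1 := by
    refine (norm_add_le _ _).trans (add_le_add ?_ ?_)
    · rw [norm_smul, smul_smul, norm_smul, norm_smul, hinner, h3r]
      gcongr
    · rw [norm_smul]
      gcongr
  refine e1.trans ?_
  have h5 : r ^ 3 * (1 + r ^ 3)⁻¹ ≤ 1 := by
    rw [← div_eq_mul_inv, div_le_one hq]
    linarith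
  have h6 : 0 ≤ (1 + r ^ 3)⁻¹ := by positivity
  rw [← inv_pow]
  nlinarith

theorem integrable_fderiv_regK (i : Fin 2) (v : Plane) :
    Integrable fun z => fderiv ℝ (regK i) z v := by
  refine (integrable_one_add_norm_cube.const_mul (16 * ‖v‖)).mono'
    (measurable_fderiv_apply_const ℝ (regK i) v).aestronglyMeasurable (.of_forall fun z => ?_)
  obtain ⟨A, hA, hb⟩ := hasFDerivAt_regK i z
  rw [hA.fderiv]
  refine (A.le_opNorm v).trans ((mul_le_mul_of_nonneg_right hb (norm_nonneg v)).trans_eq ?_)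
  ring

/-- At infinity `regK` decays only like `|z|⁻²`, which is not integrable. Integrating by parts moves
`∂ⱼ` onto it, and the gradient of `regK` is integrable, so the result is a convolution of two `L¹`
functions. This is why a derivative must accompany `K`. -/
theorem integrable_regPart_partialDeriv (i j : Fin 2) {h : Plane → ℝ} (hd : Differentiable ℝ h)
    (hi : Integrable h) (hi' : Integrable (partialDeriv j h)) :
    Integrable (regPart i (partialDeriv j h)) := by
  have hfi := integrable_fderiv_regK i (basisVec j)
  have hconv : Integrable fun x => ∫ z, fderiv ℝ (regK i) z (basisVec j) * h (x - z) :=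
    hfi.integrable_convolution (ContinuousLinearMap.mul ℝ ℝ) hi
  convert hconv using 1
  funext x
  have hdg : ∀ z, HasFDerivAt (fun z => h (x - z)) (-fderiv ℝ h (x - z)) z := by
    intro z
    have := (hd (x - z)).hasFDerivAt.comp z ((hasFDerivAt_id z).const_sub x)
    refine this.congr_fderiv ?_
    ext v
    simp
  have hfd : ∀ z, fderiv ℝ (fun z => h (x - z)) z (basisVec j) = -partialDeriv j h (x - z) := by
    intro z
    rw [(hdg z).fderiv]
    rfl
  have hbd : ∀ z, ‖fderiv ℝ (regK i) z (basisVec j)‖ ≤ 16 := by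
    intro z
    obtain ⟨A, hA, hb⟩ := hasFDerivAt_regK i z
    rw [hA.fderiv]
    refine (A.le_opNorm _).trans ?_
    rw [norm_basisVec, mul_one]
    refine hb.trans (mul_le_of_le_one_right (by norm_num) ?_)
    exact Real.rpow_le_one_of_one_le_of_nonpos (by linarith [norm_nonneg z]) (by norm_num)
  have key := integral_mul_fderiv_eq_neg_fderiv_mul_of_integrable (μ := (volume : Measure Plane))
    (f := regK i) (g := fun z => h (x - z)) (v := basisVec j)
    ((hi.comp_sub_left x).bdd_mul hfi.1 (.of_forall hbd))
    (by
      simp only [hfd, mul_neg]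
      exact (integrable_regPart_integrand i hi' x).neg)
    (integrable_regPart_integrand i hi x)
    (fun z _ => by
      obtain ⟨A, hA, -⟩ := hasFDerivAt_regK i z
      exact hA.differentiableAt)
    (fun z _ => (hdg z).differentiableAt)
  simp only [hfd, mul_neg] at key
  rw [integral_neg] at key
  exact neg_injective key

theorem stronglyMeasurable_singPart (i : Fin 2) {φ : Plane → ℝ} (hφ : Continuous φ) :
    StronglyMeasurable (singPart i φ) := by
  have h1 := hφ.measurable
  have h2 := measurable_singK i
  exact (Measurable.stronglyMeasurable (by fun_prop : Measurable fun q : Plane × Plane =>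
    singK i q.2 * (φ (q.1 - q.2) - φ q.1))).integral_prod_right'

theorem stronglyMeasurable_regPart (i : Fin 2) {φ : Plane → ℝ} (hφ : Continuous φ) :
    StronglyMeasurable (regPart i φ) := by
  have h1 := hφ.measurable
  have h2 := (continuous_regK i).measurable
  exact (Measurable.stronglyMeasurable (by fun_prop : Measurable fun q : Plane × Plane =>
    regK i q.2 * φ (q.1 - q.2))).integral_prod_right'

theorem HasPVConvK.pvConvK_eq {i : Fin 2} {φ : Plane → ℝ} {x : Plane} {l : ℝ}
    (h : HasPVConvK i φ x l) : pvConvK i φ x = l :=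
  Tendsto.limUnder_eq h

/-- The principal value convolution of `kernelK i` with a partial derivative of a smooth decaying
function exists everywhere and is integrable. -/
theorem pvConvK_partialDeriv (i j : Fin 2) {h : Plane → ℝ} (hh : ContDiff ℝ 2 h)
    (hh' : ContDiff ℝ 1 (partialDeriv j h)) (h0 : HasCubicDecay h)
    (h1 : HasCubicDecay (partialDeriv j h))
    (h2 : ∀ m, HasCubicDecay (partialDeriv m (partialDeriv j h))) :
    (∀ x, HasPVConvK i (partialDeriv j h) x (pvConvK i (partialDeriv j h) x)) ∧
      StronglyMeasurable (pvConvK i (partialDeriv j h)) ∧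
      Integrable (pvConvK i (partialDeriv j h)) := by
  have hd := hh'.differentiable one_ne_zero
  have hint := h1.integrable hh'.continuous
  obtain ⟨L, hL⟩ := exists_lipschitz_of_decay hd h2
  obtain ⟨B, hB⟩ := exists_integral_translation_le hd hint h2
  have hpv := hasPVConvK_of_lipschitz i hint hL
  have e : pvConvK i (partialDeriv j h) = fun x =>
      singPart i (partialDeriv j h) x + regPart i (partialDeriv j h) x :=
    funext fun x => (hpv x).pvConvK_eq
  rw [e]
  exact ⟨hpv, (stronglyMeasurable_singPart i hh'.continuous).add
    (stronglyMeasurable_regPart i hh'.continuous),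
    (integrable_singPart i hint hh'.continuous hB).add (integrable_regPart_partialDeriv i j
      (hh.differentiable two_ne_zero) (h0.integrable hh.continuous) hint)⟩

end Kernel

/-! ### Self-similarity of the heat kernel and of `K` -/

section Scaling

/-- As `K` has degree `-2`, its homogeneity cancels the Jacobian of `z ↦ λz` in the plane. The
truncations `(ε, R)` become `(λε, λR)`, which leaves the limit unchanged; `λ³` is merely the
normalization of a differentiated heat kernel. -/
theorem hasPVConvK_scale (i : Fin 2) {φ : Plane → ℝ} {x : Plane} {l lam : ℝ} (hl : 0 < lam)
    (h : HasPVConvK i φ (lam • x) l) :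
    HasPVConvK i (fun y => lam ^ 3 * φ (lam • y)) x (lam ^ 3 * l) := by
  have htr : ∀ p : ℝ × ℝ, truncConvK i (fun y => lam ^ 3 * φ (lam • y)) x p =
      lam ^ 3 * truncConvK i φ (lam • x) (lam * p.1, lam * p.2) := by
    intro p
    rw [truncConvK_eq, truncConvK_eq, ← integral_indicator (measurableSet_annulus _),
      ← integral_indicator (measurableSet_annulus _)]
    have hs := Measure.integral_comp_smul (volume : Measure Plane)
      ((annulus (lam * p.1, lam * p.2)).indicator fun z => kernelK i z * φ (lam • x - z)) lam
    rw [finrank_euclideanSpace, Fintype.card_fin, abs_of_pos (by positivity), smul_eq_mul] at hs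
    have hs' : ∫ z, (annulus (lam * p.1, lam * p.2)).indicator
        (fun z => kernelK i z * φ (lam • x - z)) z = lam ^ 2 * ∫ z, (annulus (lam * p.1,
          lam * p.2)).indicator (fun z => kernelK i z * φ (lam • x - z)) (lam • z) := by
      rw [hs, mul_inv_cancel_left₀ (by positivity)]
    rw [hs', ← integral_const_mul, ← integral_const_mul]
    refine integral_congr_ae (.of_forall fun z => ?_)
    have hm : lam • z ∈ annulus (lam * p.1, lam * p.2) ↔ z ∈ annulus p := by
      simp only [annulus, Set.mem_ofPred_eq, norm_smul, Real.norm_of_nonneg hl.le]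
      rw [mul_lt_mul_iff_right₀ hl, mul_lt_mul_iff_right₀ hl]
    by_cases hz : z ∈ annulus p
    · simp only [Set.indicator_of_mem hz, Set.indicator_of_mem (hm.2 hz), smul_sub]
      have hk : kernelK i z = lam ^ 2 * kernelK i (lam • z) := by
        rw [kernelK_eq, kernelK_eq, norm_smul, Real.norm_of_nonneg hl.le, map_smul, smul_eq_mul]
        rcases eq_or_ne z 0 with rfl | hz0
        · simp
        · have := norm_pos_iff.2 hz0
          field_simp
      rw [hk]
      ring
    · simp only [Set.indicator_of_notMem hz, Set.indicator_of_notMem (fun h => hz (hm.1 h)),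
        mul_zero]
  rw [HasPVConvK, show truncConvK i (fun y => lam ^ 3 * φ (lam • y)) x = _ from funext htr]
  refine Tendsto.const_mul _ (Tendsto.comp h (Tendsto.prodMap ?_ ?_))
  · refine tendsto_nhdsWithin_of_tendsto_nhds_of_eventually_within _ ?_ ?_
    · have : Tendsto (fun a : ℝ => lam * a) (𝓝 0) (𝓝 (lam * 0)) :=
        (continuous_const_mul lam).tendsto 0
      rw [mul_zero] at this
      exact this.mono_left nhdsWithin_le_nhds
    · filter_upwards [self_mem_nhdsWithin] with a ha
      exact mul_pos hl ha
  · exact tendsto_id.const_mul_atTop hl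

theorem partialDeriv_scale (j : Fin 2) {h : Plane → ℝ} (hd : Differentiable ℝ h) (c lam : ℝ)
    (x : Plane) : partialDeriv j (fun y => c * h (lam • y)) x =
      c * lam * partialDeriv j h (lam • x) := by
  have h1 := ((hd (lam • x)).hasFDerivAt.comp x ((hasFDerivAt_id x).const_smul lam)).const_mul c
  have h2 := h1.fderiv
  simp only [Function.comp_def] at h2
  rw [partialDeriv, h2]
  simp [partialDeriv, mul_assoc]

/-- Substituting `ξ ↦ λ⁻¹ξ` with `λ = t^(-1/(2α))` turns the time-one symbol into the symbol at time
`t`. -/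
theorem heatKernel_scale (ν α : ℝ) (hα : α ≠ 0) {t : ℝ} (ht : 0 < t) (x : Plane) :
    heatKernel ν α t x = (t ^ (-(1 / (2 * α)))) ^ 2 *
      heatKernel ν α 1 (t ^ (-(1 / (2 * α))) • x) := by
  set lam := t ^ (-(1 / (2 * α))) with hlam
  have hl : 0 < lam := Real.rpow_pos_of_pos ht _
  set f : Plane → ℂ := fun w => Complex.exp (↑(2 * Real.pi * inner ℝ w (lam • x)) * Complex.I) •
    ((Real.exp (-(ν * 1 * (2 * Real.pi * ‖w‖) ^ (2 * α))) : ℝ) : ℂ) with hf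
  have hs := Measure.integral_comp_smul (volume : Measure Plane) f lam⁻¹
  rw [finrank_euclideanSpace, Fintype.card_fin, abs_of_pos (by positivity), inv_pow, inv_inv] at hs
  have h1 : 𝓕⁻ (fun ξ : Plane =>
      ((Real.exp (-(ν * t * (2 * Real.pi * ‖ξ‖) ^ (2 * α))) : ℝ) : ℂ)) x =
      ∫ ξ, f (lam⁻¹ • ξ) := by
    rw [Real.fourierInv_eq']
    refine integral_congr_ae (.of_forall fun ξ => ?_)
    simp only [hf]
    have e1 : inner ℝ (lam⁻¹ • ξ) (lam • x) = inner ℝ ξ x := by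
      rw [real_inner_smul_left, real_inner_smul_right, inv_mul_cancel_left₀ hl.ne']
    have e2 : (2 * Real.pi * ‖lam⁻¹ • ξ‖) ^ (2 * α) = t * (2 * Real.pi * ‖ξ‖) ^ (2 * α) := by
      rw [norm_smul, Real.norm_of_nonneg (by positivity), mul_left_comm,
        Real.mul_rpow (by positivity) (by positivity), hlam, ← Real.rpow_neg ht.le, neg_neg,
        ← Real.rpow_mul ht.le, one_div_mul_cancel (by simpa using hα), Real.rpow_one]
    rw [e1, e2, mul_one, mul_assoc ν]
  rw [heatKernel, h1, hs, heatKernel, Real.fourierInv_eq', Complex.smul_re, smul_eq_mul]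

end Scaling

/-! ### Multi-index derivatives versus iterated Fréchet derivatives -/

section MultiDerivatives

theorem partialDeriv_eq_comp (i : Fin 2) (f : Plane → ℝ) :
    partialDeriv i f = ContinuousLinearMap.apply ℝ ℝ (basisVec i) ∘ fderiv ℝ f := rfl

theorem contDiff_partialDeriv (i : Fin 2) {f : Plane → ℝ} {n : ℕ}
    (hf : ContDiff ℝ (n + 1 : ℕ) f) : ContDiff ℝ n (partialDeriv i f) := by
  rw [partialDeriv_eq_comp]
  exact (ContinuousLinearMap.apply ℝ ℝ (basisVec i)).contDiff.comp (hf.fderiv_right (m := n)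
    (by push_cast; exact le_rfl))

theorem norm_iteratedFDeriv_partialDeriv_le (i : Fin 2) {f : Plane → ℝ} {n : ℕ}
    (hf : ContDiff ℝ (n + 1 : ℕ) f) (x : Plane) :
    ‖iteratedFDeriv ℝ n (partialDeriv i f) x‖ ≤ ‖iteratedFDeriv ℝ (n + 1) f x‖ := by
  have hf' : ContDiff ℝ n (fderiv ℝ f) := hf.fderiv_right (m := n) (by push_cast; exact le_rfl)
  rw [partialDeriv_eq_comp, ← norm_iteratedFDeriv_fderiv]
  refine ((ContinuousLinearMap.apply ℝ ℝ (basisVec i)).norm_iteratedFDeriv_comp_left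
    hf'.contDiffAt le_rfl).trans (mul_le_of_le_one_left (norm_nonneg _) ?_)
  refine ContinuousLinearMap.opNorm_le_bound _ zero_le_one fun A => ?_
  rw [one_mul, ContinuousLinearMap.apply_apply]
  exact (A.le_opNorm _).trans_eq (by rw [norm_basisVec, mul_one])

theorem contDiff_iterate_partialDeriv (i : Fin 2) (m : ℕ) {n : ℕ} {f : Plane → ℝ}
    (hf : ContDiff ℝ (n + m : ℕ) f) : ContDiff ℝ n ((partialDeriv i)^[m] f) := by
  induction m generalizing f with
  | zero => exact hf
  | succ m ih =>
    rw [Function.iterate_succ_apply]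
    exact ih (contDiff_partialDeriv i hf)

theorem norm_iteratedFDeriv_iterate_partialDeriv_le (i : Fin 2) (m : ℕ) {n : ℕ}
    {f : Plane → ℝ} (hf : ContDiff ℝ (n + m : ℕ) f) (x : Plane) :
    ‖iteratedFDeriv ℝ n ((partialDeriv i)^[m] f) x‖ ≤ ‖iteratedFDeriv ℝ (n + m) f x‖ := by
  induction m generalizing f with
  | zero => exact le_rfl
  | succ m ih =>
    rw [Function.iterate_succ_apply]
    exact (ih (contDiff_partialDeriv i hf)).trans (norm_iteratedFDeriv_partialDeriv_le i hf x)

/-- Each partial derivative fills one slot of the Fréchet derivative with a unit vector, which does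
not increase the norm. -/
theorem abs_multiDeriv_le (β : Fin 2 → ℕ) {f : Plane → ℝ}
    (hf : ContDiff ℝ (β 0 + β 1 : ℕ) f) (x : Plane) :
    |multiDeriv β f x| ≤ ‖iteratedFDeriv ℝ (β 0 + β 1) f x‖ := by
  have h1 : ContDiff ℝ (0 + β 0 : ℕ) ((partialDeriv 1)^[β 1] f) := by
    rw [zero_add]
    exact contDiff_iterate_partialDeriv 1 (β 1) hf
  have h2 := norm_iteratedFDeriv_iterate_partialDeriv_le 0 (β 0) h1 x
  rw [norm_iteratedFDeriv_zero, zero_add] at h2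
  exact h2.trans (norm_iteratedFDeriv_iterate_partialDeriv_le 1 (β 1) hf x)

theorem partialDeriv_comm {f : Plane → ℝ} (hf : ContDiff ℝ 2 f) :
    partialDeriv 1 (partialDeriv 0 f) = partialDeriv 0 (partialDeriv 1 f) := by
  have hd : Differentiable ℝ (fderiv ℝ f) :=
    (hf.fderiv_right (m := 1) (by norm_num)).differentiable one_ne_zero
  have h : ∀ (i j : Fin 2) (x : Plane), partialDeriv j (partialDeriv i f) x =
      fderiv ℝ (fderiv ℝ f) x (basisVec j) (basisVec i) := by
    intro i j x
    have h1 := (ContinuousLinearMap.apply ℝ ℝ (basisVec i)).hasFDerivAt.comp x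
      (hd x).hasFDerivAt
    rw [partialDeriv, partialDeriv_eq_comp, h1.fderiv]
    rfl
  funext x
  rw [h, h]
  exact (hf.contDiffAt.isSymmSndFDerivAt (by simp)).eq _ _

theorem iterate_partialDeriv_comm (b : ℕ) {f : Plane → ℝ} (hf : ContDiff ℝ (b + 1 : ℕ) f) :
    (partialDeriv 1)^[b] (partialDeriv 0 f) = partialDeriv 0 ((partialDeriv 1)^[b] f) := by
  induction b generalizing f with
  | zero => rfl
  | succ b ih =>
    have h2 : ContDiff ℝ 2 f := hf.of_le (by
      norm_cast
      lia)
    rw [Function.iterate_succ_apply, Function.iterate_succ_apply, partialDeriv_comm h2,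
      ih (contDiff_partialDeriv 1 hf)]

/-- `multiDeriv` applies `∂₁` before `∂₀`. Raising `β 1` is therefore definitional, while raising `β
0` needs symmetry of second derivatives to move `∂₀` past the powers of `∂₁`. -/
theorem IsCkb.partialDeriv {k : ℕ} {f : Plane → ℝ} (hf : IsCkb (k + 1) f) (i : Fin 2) :
    IsCkb k (partialDeriv i f) := by
  refine ⟨contDiff_partialDeriv i hf.1, fun β hβ => ?_⟩
  fin_cases i
  · obtain ⟨C, hC⟩ := hf.2 ![β 0 + 1, β 1] (by simp; lia)
    refine ⟨C, fun x => ?_⟩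
    have e : multiDeriv β (DissipativeSQG.partialDeriv 0 f) =
        multiDeriv ![β 0 + 1, β 1] f := by
      have hc : ContDiff ℝ (β 1 + 1 : ℕ) f := hf.1.of_le (by
        norm_cast
        lia)
      simp only [multiDeriv, Matrix.cons_val_zero, Matrix.cons_val_one,
        Function.iterate_succ_apply]
      rw [iterate_partialDeriv_comm _ hc]
    exact (congrArg (|·|) (congrFun e x)).trans_le (hC x)
  · obtain ⟨C, hC⟩ := hf.2 ![β 0, β 1 + 1] (by simp; lia)
    exact ⟨C, hC⟩

/-- The Fréchet derivative is the image of the pair of partials under a fixed linear map `Φ`, so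
induction on `k` through the partials applies. The abstract regularity theorem takes its bounds in
this form. -/
theorem IsCkb.exists_iteratedFDeriv_bound {k : ℕ} {f : Plane → ℝ} (hf : IsCkb k f) :
    ∀ j ≤ k, ∃ B, ∀ x, ‖iteratedFDeriv ℝ j f x‖ ≤ B := by
  induction k generalizing f with
  | zero =>
    intro j hj
    obtain rfl : j = 0 := by lia
    obtain ⟨C, hC⟩ := hf.2 0 (by simp)
    refine ⟨C, fun x => ?_⟩
    rw [norm_iteratedFDeriv_zero]
    exact hC x
  | succ k ih =>
    intro j hj
    rcases j with _ | j
    · obtain ⟨C, hC⟩ := hf.2 0 (by simp)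
      refine ⟨C, fun x => ?_⟩
      rw [norm_iteratedFDeriv_zero]
      exact hC x
    · obtain ⟨B₀, h0⟩ := ih (hf.partialDeriv 0) j (by lia)
      obtain ⟨B₁, h1⟩ := ih (hf.partialDeriv 1) j (by lia)
      let Φ : ℝ × ℝ →L[ℝ] Plane →L[ℝ] ℝ :=
        (ContinuousLinearMap.fst ℝ ℝ ℝ).smulRight (EuclideanSpace.proj 0 : Plane →L[ℝ] ℝ) +
        (ContinuousLinearMap.snd ℝ ℝ ℝ).smulRight (EuclideanSpace.proj 1 : Plane →L[ℝ] ℝ)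
      have hΦ : fderiv ℝ f = Φ ∘ fun x =>
          (DissipativeSQG.partialDeriv 0 f x, DissipativeSQG.partialDeriv 1 f x) := by
        funext x
        ext v
        have hv : v = v 0 • basisVec 0 + v 1 • basisVec 1 := by
          ext j
          fin_cases j <;> simp [basisVec]
        conv_lhs => rw [hv]
        simp [Φ, DissipativeSQG.partialDeriv]
        ring
      have c0 : ContDiff ℝ j (DissipativeSQG.partialDeriv 0 f) := (hf.partialDeriv 0).1.of_le (by
        norm_cast
        lia)
      have c1 : ContDiff ℝ j (DissipativeSQG.partialDeriv 1 f) := (hf.partialDeriv 1).1.of_le (by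
        norm_cast
        lia)
      refine ⟨‖Φ‖ * max B₀ B₁, fun x => ?_⟩
      rw [← norm_iteratedFDeriv_fderiv, hΦ]
      refine (Φ.norm_iteratedFDeriv_comp_left (c0.prodMk c1).contDiffAt le_rfl).trans ?_
      refine mul_le_mul_of_nonneg_left ?_ (norm_nonneg _)
      rw [iteratedFDeriv_prodMk c0.contDiffAt c1.contDiffAt le_rfl,
        ContinuousMultilinearMap.opNorm_prod]
      exact max_le_max (h0 x) (h1 x)

/-- A function that agrees almost everywhere with a component of a vector-valued function with
bounded derivatives is a `C^k` function with the same bounds. -/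
theorem hasCkBound_of_component {E : Type} [NormedAddCommGroup E] [NormedSpace ℝ E] {k : ℕ}
    {M : ℝ} {G : Plane → E} (hG : ContDiff ℝ k G)
    (hM : ∀ j ≤ k, ∀ x, ‖iteratedFDeriv ℝ j G x‖ ≤ M) (π : E →L[ℝ] ℝ) (hπ : ‖π‖ ≤ 1)
    {a : Plane → ℝ} (ha : a =ᵐ[volume] fun x => π (G x)) : HasCkBound k M a := by
  have hc : ContDiff ℝ k fun x => π (G x) := π.contDiff.comp hG
  refine ⟨_, hc, ha, fun β hβ x => ?_⟩
  have hle : ((β 0 + β 1 : ℕ) : WithTop ℕ∞) ≤ k := by exact_mod_cast hβ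
  refine (abs_multiDeriv_le β (hc.of_le hle) x).trans ?_
  refine (π.norm_iteratedFDeriv_comp_left hG.contDiffAt hle).trans ?_
  exact (mul_le_of_le_one_left (norm_nonneg _) hπ).trans (hM _ hβ x)

end MultiDerivatives

set_option maxSynthPendingDepth 3

/-! ### Dilations of an integrable profile as kernel families -/

section KernelFamilies

/-- The self-similar family of kernels `τ ↦ λ^n k(λ z)`, `λ = τ^(-γ)`. -/
def scaledKernel (γ : ℝ) (n : ℕ) (k : Plane → ℝ) (τ : ℝ) (z : Plane) : ℝ :=
  (τ ^ (-γ)) ^ n * k (τ ^ (-γ) • z)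

/-- In the plane `λ^(m+2) k(λ·)` has `L¹` norm `λ^m ‖k‖₁`. Here `m` counts derivatives: `0` for the
heat kernel, `1` for `∂ⱼg` and also for `K * ∂ⱼg`, since `K` acts as an operator of order zero. -/
theorem isKernelFamily_scaledKernel (γ : ℝ) (m : ℕ) {k : Plane → ℝ} (hk : StronglyMeasurable k)
    (hi : Integrable k) :
    IsKernelFamily (γ * m) (∫ z, ‖k z‖) (scaledKernel γ (m + 2) k) := by
  refine ⟨?_, fun τ hτ => ?_, fun τ hτ => ?_⟩
  · have hk' := hk.measurable
    refine Measurable.stronglyMeasurable ?_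
    change Measurable fun p : ℝ × Plane => (p.1 ^ (-γ)) ^ (m + 2) * k (p.1 ^ (-γ) • p.2)
    fun_prop
  · exact (hi.comp_smul (Real.rpow_pos_of_pos hτ _).ne').const_mul _
  · have hl : 0 < τ ^ (-γ) := Real.rpow_pos_of_pos hτ _
    have hs := Measure.integral_comp_smul (volume : Measure Plane) (fun z => ‖k z‖) (τ ^ (-γ))
    rw [finrank_euclideanSpace, Fintype.card_fin, abs_of_pos (by positivity), smul_eq_mul] at hs
    simp only [scaledKernel, norm_mul, norm_pow, Real.norm_of_nonneg hl.le]
    rw [integral_const_mul, hs, ← neg_mul, Real.rpow_mul hτ.le, Real.rpow_natCast]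
    refine le_of_eq ?_
    field_simp
    ring

variable {X : Type} [NormedAddCommGroup X] [MeasureSpace X]

theorem IsKernelFamily.smul_const {A : Type} [NormedAddCommGroup A] [NormedSpace ℝ A] {γ C : ℝ}
    {k : ℝ → X → ℝ} (hk : IsKernelFamily γ C k) (b : A) :
    IsKernelFamily γ (C * ‖b‖) fun τ z => k τ z • b := by
  refine ⟨hk.meas.smul_const b, fun τ hτ => (hk.integrable τ hτ).smul_const b, fun τ hτ => ?_⟩
  simp only [norm_smul]
  rw [integral_mul_const, mul_right_comm]
  exact mul_le_mul_of_nonneg_right (hk.bound τ hτ) (norm_nonneg b)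

theorem IsKernelFamily.add {A : Type} [NormedAddCommGroup A] {γ C D : ℝ} {k l : ℝ → X → A}
    (hk : IsKernelFamily γ C k) (hl : IsKernelFamily γ D l) :
    IsKernelFamily γ (C + D) fun τ z => k τ z + l τ z := by
  refine ⟨hk.meas.add hl.meas, fun τ hτ => (hk.integrable τ hτ).add (hl.integrable τ hτ),
    fun τ hτ => ?_⟩
  rw [add_mul]
  refine le_trans ?_ (add_le_add (hk.bound τ hτ) (hl.bound τ hτ))
  rw [← integral_add (hk.integrable τ hτ).norm (hl.integrable τ hτ).norm]
  exact integral_mono ((hk.integrable τ hτ).add (hl.integrable τ hτ)).norm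
    ((hk.integrable τ hτ).norm.add (hl.integrable τ hτ).norm) fun z => norm_add_le _ _

end KernelFamilies

/-! ### The SQG system as a single quadratic Duhamel equation -/

section System

/-- The state space of the values `(θ, u₁, u₂)`. -/
abbrev State : Type := ℝ × ℝ × ℝ

/-- The scalar component of a state. -/
def thetaComp : State →L[ℝ] ℝ := ContinuousLinearMap.fst ℝ ℝ (ℝ × ℝ)

/-- The velocity components of a state. -/
def velComp (j : Fin 2) : State →L[ℝ] ℝ :=
  (![ContinuousLinearMap.fst ℝ ℝ ℝ, ContinuousLinearMap.snd ℝ ℝ ℝ] j).comp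
    (ContinuousLinearMap.snd ℝ ℝ (ℝ × ℝ))

/-- The bilinear map `(v, w) ↦ v_θ w_j e`. -/
def fluxBilin (j : Fin 2) (e : State) : State →L[ℝ] State →L[ℝ] State :=
  thetaComp.smulRight ((velComp j).smulRight e)

theorem fluxBilin_apply (j : Fin 2) (e v w : State) :
    fluxBilin j e v w = (thetaComp v * velComp j w) • e := by
  simp [fluxBilin, smul_smul]

theorem norm_thetaComp_le : ‖thetaComp‖ ≤ 1 := ContinuousLinearMap.norm_fst_le ..

theorem norm_velComp_le (j : Fin 2) : ‖velComp j‖ ≤ 1 := by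
  refine (velComp j).opNorm_le_bound zero_le_one fun v => ?_
  rw [one_mul]
  have h : ‖v.2‖ ≤ ‖v‖ := norm_snd_le v
  fin_cases j
  · exact (norm_fst_le v.2).trans h
  · exact (norm_snd_le v.2).trans h

/-- The kernel of bilinear maps of the Duhamel system for `(θ, u₁, u₂)`. -/
def sqgKernel (ν α : ℝ) (τ : ℝ) (z : Plane) : State →L[ℝ] State →L[ℝ] State :=
  (scaledKernel (1 / (2 * α)) (1 + 2) (partialDeriv 0 (heatKernel ν α 1)) τ z •
      fluxBilin 0 (1, 0, 0) +
    scaledKernel (1 / (2 * α)) (1 + 2) (partialDeriv 1 (heatKernel ν α 1)) τ z •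
      fluxBilin 1 (1, 0, 0)) +
  ((scaledKernel (1 / (2 * α)) (1 + 2) (pvConvK 0 (partialDeriv 0 (heatKernel ν α 1))) τ z •
      fluxBilin 0 (0, 1, 0) +
    scaledKernel (1 / (2 * α)) (1 + 2) (pvConvK 0 (partialDeriv 1 (heatKernel ν α 1))) τ z •
      fluxBilin 1 (0, 1, 0)) +
  (scaledKernel (1 / (2 * α)) (1 + 2) (pvConvK 1 (partialDeriv 0 (heatKernel ν α 1))) τ z •
      fluxBilin 0 (0, 0, 1) +
    scaledKernel (1 / (2 * α)) (1 + 2) (pvConvK 1 (partialDeriv 1 (heatKernel ν α 1))) τ z •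
      fluxBilin 1 (0, 0, 1)))

variable {ν α : ℝ}

theorem pvConvK_heat (hν : 0 < ν) (hα : 1 / 2 < α) (i j : Fin 2) :
    (∀ x, HasPVConvK i (partialDeriv j (heatKernel ν α 1)) x
      (pvConvK i (partialDeriv j (heatKernel ν α 1)) x)) ∧
      StronglyMeasurable (pvConvK i (partialDeriv j (heatKernel ν α 1))) ∧
      Integrable (pvConvK i (partialDeriv j (heatKernel ν α 1))) := by
  have h0 : IsHeatMoment ν α (heatKernel ν α 1) := isHeatMoment_heatKernel_one
  have h1 := h0.partialDeriv hν hα j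
  exact pvConvK_partialDeriv i j (h0.contDiff hν hα 2) (h1.contDiff hν hα 1)
    (h0.hasCubicDecay hν hα) (h1.hasCubicDecay hν hα)
    fun m => (h1.partialDeriv hν hα m).hasCubicDecay hν hα

theorem isKernelFamily_heat (hν : 0 < ν) (hα : 1 / 2 < α) :
    ∃ C, IsKernelFamily 0 C (scaledKernel (1 / (2 * α)) (0 + 2) (heatKernel ν α 1)) := by
  have h0 : IsHeatMoment ν α (heatKernel ν α 1) := isHeatMoment_heatKernel_one
  have hc := (h0.contDiff hν hα 0).continuous
  have := isKernelFamily_scaledKernel (1 / (2 * α)) 0 hc.stronglyMeasurable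
    ((h0.hasCubicDecay hν hα).integrable hc)
  exact ⟨_, by simpa using this⟩

theorem isKernelFamily_gradHeat (hν : 0 < ν) (hα : 1 / 2 < α) (j : Fin 2) :
    ∃ C, IsKernelFamily (1 / (2 * α)) C
      (scaledKernel (1 / (2 * α)) (1 + 2) (partialDeriv j (heatKernel ν α 1))) := by
  have h1 := isHeatMoment_heatKernel_one.partialDeriv hν hα j
  have hc := (h1.contDiff hν hα 0).continuous
  have := isKernelFamily_scaledKernel (1 / (2 * α)) 1 hc.stronglyMeasurable
    ((h1.hasCubicDecay hν hα).integrable hc)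
  rw [Nat.cast_one, mul_one] at this
  exact ⟨_, this⟩

theorem isKernelFamily_gradHeatK (hν : 0 < ν) (hα : 1 / 2 < α) (i j : Fin 2) :
    ∃ C, IsKernelFamily (1 / (2 * α)) C
      (scaledKernel (1 / (2 * α)) (1 + 2) (pvConvK i (partialDeriv j (heatKernel ν α 1)))) := by
  obtain ⟨-, hm, hi⟩ := pvConvK_heat hν hα i j
  have := isKernelFamily_scaledKernel (1 / (2 * α)) 1 hm hi
  rw [Nat.cast_one, mul_one] at this
  exact ⟨_, this⟩

theorem isKernelFamily_sqgKernel (hν : 0 < ν) (hα : 1 / 2 < α) :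
    ∃ C, IsKernelFamily (1 / (2 * α)) C (sqgKernel ν α) := by
  obtain ⟨_, h0⟩ := isKernelFamily_gradHeat hν hα 0
  obtain ⟨_, h1⟩ := isKernelFamily_gradHeat hν hα 1
  obtain ⟨_, h00⟩ := isKernelFamily_gradHeatK hν hα 0 0
  obtain ⟨_, h01⟩ := isKernelFamily_gradHeatK hν hα 0 1
  obtain ⟨_, h10⟩ := isKernelFamily_gradHeatK hν hα 1 0
  obtain ⟨_, h11⟩ := isKernelFamily_gradHeatK hν hα 1 1
  have a0 := (h0.smul_const (fluxBilin 0 (1, 0, 0))).add (h1.smul_const (fluxBilin 1 (1, 0, 0)))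
  have a1 := (h00.smul_const (fluxBilin 0 (0, 1, 0))).add (h01.smul_const (fluxBilin 1 (0, 1, 0)))
  have a2 := (h10.smul_const (fluxBilin 0 (0, 0, 1))).add (h11.smul_const (fluxBilin 1 (0, 0, 1)))
  exact ⟨_, a0.add (a1.add a2)⟩

theorem heatKernel_eq_scaledKernel (hα : 1 / 2 < α) {t : ℝ} (ht : 0 < t) :
    heatKernel ν α t = scaledKernel (1 / (2 * α)) (0 + 2) (heatKernel ν α 1) t :=
  funext fun x => heatKernel_scale ν α (by linarith) ht x

theorem partialDeriv_heatKernel_eq (hν : 0 < ν) (hα : 1 / 2 < α) (j : Fin 2) {t : ℝ}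
    (ht : 0 < t) : partialDeriv j (heatKernel ν α t) =
      scaledKernel (1 / (2 * α)) (1 + 2) (partialDeriv j (heatKernel ν α 1)) t := by
  have hd : Differentiable ℝ (heatKernel ν α 1) :=
    (isHeatMoment_heatKernel_one.contDiff hν hα 1).differentiable (by simp)
  funext x
  rw [heatKernel_eq_scaledKernel hα ht]
  refine (partialDeriv_scale j hd _ _ x).trans ?_
  rw [scaledKernel]
  ring

theorem pvConvK_heatKernel_eq (hν : 0 < ν) (hα : 1 / 2 < α) (i j : Fin 2) {t : ℝ}
    (ht : 0 < t) : pvConvK i (partialDeriv j (heatKernel ν α t)) =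
      scaledKernel (1 / (2 * α)) (1 + 2) (pvConvK i (partialDeriv j (heatKernel ν α 1))) t := by
  funext x
  rw [partialDeriv_heatKernel_eq hν hα j ht]
  exact (hasPVConvK_scale i (Real.rpow_pos_of_pos ht _) ((pvConvK_heat hν hα i j).1 _)).pvConvK_eq

theorem integral_mul_comp_sub_eq_conv (k a : Plane → ℝ) (x : Plane) :
    ∫ z, k z * a (x - z) = conv k a x := by
  rw [conv, ← integral_sub_left_eq_self (fun z => k z * a (x - z)) volume x]
  simp only [sub_sub_cancel]

theorem conv_congr_ae (k : Plane → ℝ) {a b : Plane → ℝ} (h : a =ᵐ[volume] b) (x : Plane) :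
    conv k a x = conv k b x := by
  refine integral_congr_ae ?_
  filter_upwards [h] with y hy
  rw [hy]

/-- A component of the quadratic convolution, for a kernel acting through the flux `θ u`. -/
theorem clm_quadConv_eq {N : Plane → State →L[ℝ] State →L[ℝ] State} (hN : Integrable N)
    {v : Plane → State} (hv : StronglyMeasurable v) {M : ℝ} (hM : ∀ y, ‖v y‖ ≤ M)
    (π : State →L[ℝ] ℝ) {k : Fin 2 → Plane → ℝ} (hk : ∀ j, Integrable (k j))
    (hπ : ∀ z w, π (N z w w) = ∑ j, k j z * (thetaComp w * velComp j w)) (x : Plane) :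
    π (quadConv N v x) = ∑ j, conv (k j) (fun y => thetaComp (v y) * velComp j (v y)) x := by
  rw [quadConv, ← π.integral_comp_comm (integrable_quadConv hN hv hM x)]
  simp only [hπ]
  rw [integral_finsetSum]
  · exact Finset.sum_congr rfl fun j _ => integral_mul_comp_sub_eq_conv (k j)
      (fun y => thetaComp (v y) * velComp j (v y)) x
  · intro j _
    have hq : StronglyMeasurable fun y => thetaComp (v y) * velComp j (v y) :=
      (thetaComp.continuous.comp_stronglyMeasurable hv).mul
        ((velComp j).continuous.comp_stronglyMeasurable hv)
    refine (hk j).mul_bdd (c := M * M) (hq.comp_measurable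
      (measurable_const.sub measurable_id)).aestronglyMeasurable (.of_forall fun z => ?_)
    have hM0 : 0 ≤ M := (norm_nonneg _).trans (hM 0)
    rw [norm_mul]
    have h1 := thetaComp.le_of_opNorm_le norm_thetaComp_le (v (x - z))
    have h2 := (velComp j).le_of_opNorm_le (norm_velComp_le j) (v (x - z))
    rw [one_mul] at h1 h2
    exact mul_le_mul (h1.trans (hM _)) (h2.trans (hM _)) (norm_nonneg _) hM0

theorem thetaComp_sqgKernel (hν : 0 < ν) (hα : 1 / 2 < α) {t : ℝ} (ht : 0 < t) (z : Plane)
    (w : State) : thetaComp (sqgKernel ν α t z w w) =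
      ∑ j, partialDeriv j (heatKernel ν α t) z * (thetaComp w * velComp j w) := by
  simp only [partialDeriv_heatKernel_eq hν hα _ ht, Fin.sum_univ_two, sqgKernel,
    add_apply, smul_apply, fluxBilin_apply]
  simp [thetaComp]

theorem velComp_sqgKernel (hν : 0 < ν) (hα : 1 / 2 < α) {t : ℝ} (ht : 0 < t) (i : Fin 2)
    (z : Plane) (w : State) : velComp i (sqgKernel ν α t z w w) =
      ∑ j, pvConvK i (partialDeriv j (heatKernel ν α t)) z * (thetaComp w * velComp j w) := by
  simp only [pvConvK_heatKernel_eq hν hα _ _ ht, Fin.sum_univ_two, sqgKernel,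
    add_apply, smul_apply, fluxBilin_apply]
  fin_cases i <;> simp [velComp]

end System

/-! ### Bounded measurable representatives -/

section Representatives

theorem exists_ae_bound_of_memLp_top {Ω F : Type*} [MeasurableSpace Ω] [NormedAddCommGroup F]
    {μ : Measure Ω} {f : Ω → F} (hf : MemLp f ⊤ μ) : ∃ C : ℝ, ∀ᵐ x ∂μ, ‖f x‖ ≤ C := by
  have h := hf.2
  rw [eLpNorm_exponent_top] at h
  refine ⟨(eLpNormEssSup f μ).toReal, ?_⟩
  filter_upwards [ae_le_eLpNormEssSup (f := f) (μ := μ)] with x hx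
  rw [← toReal_enorm]
  exact ENNReal.toReal_mono h.ne hx

theorem exists_bounded_representative {Ω F : Type*} [MeasurableSpace Ω] [NormedAddCommGroup F]
    {μ : Measure Ω} {f : Ω → F} (hf : AEStronglyMeasurable f μ) {M : ℝ} (hM : 0 ≤ M)
    (hb : ∀ᵐ x ∂μ, ‖f x‖ ≤ M) :
    ∃ g : Ω → F, StronglyMeasurable g ∧ (∀ x, ‖g x‖ ≤ M) ∧ f =ᵐ[μ] g := by
  have hm := hf.stronglyMeasurable_mk
  refine ⟨{x | ‖hf.mk f x‖ ≤ M}.indicator (hf.mk f),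
    hm.indicator (measurableSet_le hm.norm.measurable measurable_const), fun x => ?_, ?_⟩
  · by_cases hx : ‖hf.mk f x‖ ≤ M
    · rw [Set.indicator_of_mem (show x ∈ {x | ‖hf.mk f x‖ ≤ M} from hx)]
      exact hx
    · rw [Set.indicator_of_notMem (show x ∉ {x | ‖hf.mk f x‖ ≤ M} from hx), norm_zero]
      exact hM
  · filter_upwards [hf.ae_eq_mk, hb] with x hx hx'
    rw [hx] at hx'
    rw [Set.indicator_of_mem (show x ∈ {x | ‖hf.mk f x‖ ≤ M} from hx'), hx]

end Representatives

/-! ### From mild solutions to the abstract equation -/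

section MildSolutions

variable {ν α T : ℝ} {θ₀ : Plane → ℝ} {u₀ : Plane → Plane} {θ : ℝ → Plane → ℝ}
  {u : ℝ → Plane → Plane}

/-- The state `(θ, u₁, u₂)` built from a scalar and a velocity. -/
def toState (a : ℝ) (p : Plane) : State := (a, p 0, p 1)

theorem thetaComp_toState (a : ℝ) (p : Plane) : thetaComp (toState a p) = a := rfl

theorem velComp_toState (a : ℝ) (p : Plane) (j : Fin 2) : velComp j (toState a p) = p j := by
  fin_cases j <;> rfl

theorem state_ext {v w : State} (h : thetaComp v = thetaComp w)
    (h' : ∀ j, velComp j v = velComp j w) : v = w :=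
  Prod.ext h (Prod.ext (h' 0) (h' 1))

/-- The abstract theory needs joint measurability and bounds at every point, which the `L^∞`
hypotheses give only after modification on a null set of space-time. By Fubini that set is invisible
at almost every time. -/
theorem IsMildSolution.exists_representative (h : IsMildSolution ν α T θ₀ u₀ θ u) :
    ∃ (M : ℝ) (V₀ : ℝ → Plane → State), StronglyMeasurable (Function.uncurry V₀) ∧
      (∀ t x, ‖V₀ t x‖ ≤ M) ∧ ∀ᵐ s ∂volume.restrict (Set.Ioc 0 T),
        (fun y => toState (θ s y) (u s y)) =ᵐ[volume] V₀ s := by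
  obtain ⟨C₁, h1⟩ := exists_ae_bound_of_memLp_top h.theta_memLp
  obtain ⟨C₂, h2⟩ := exists_ae_bound_of_memLp_top h.u_memLp
  have hcoord : ∀ i : Fin 2, Continuous fun p : Plane => p i := fun i =>
    (EuclideanSpace.proj i : Plane →L[ℝ] ℝ).continuous
  have hm : AEStronglyMeasurable (fun z : ℝ × Plane => toState (θ z.1 z.2) (u z.1 z.2))
      ((volume.restrict (Set.Icc 0 T)).prod volume) :=
    h.theta_memLp.1.prodMk (((hcoord 0).comp_aestronglyMeasurable h.u_memLp.1).prodMk
      ((hcoord 1).comp_aestronglyMeasurable h.u_memLp.1))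
  obtain ⟨g, hg, hgM, hfg⟩ := exists_bounded_representative hm
    (M := max 0 (max C₁ C₂)) (le_max_left _ _) (by
      filter_upwards [h1, h2] with z hz1 hz2
      have hle : ∀ i, ‖u z.1 z.2 i‖ ≤ C₂ := fun i => (PiLp.norm_apply_le _ i).trans hz2
      exact le_max_of_le_right (max_le_max hz1 (max_le (hle 0) (hle 1))))
  refine ⟨_, fun t x => g (t, x), hg, fun t x => hgM _, ?_⟩
  exact ae_mono (Measure.restrict_mono Set.Ioc_subset_Icc_self le_rfl)
    (Measure.ae_ae_of_ae_prod hfg)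

theorem setIntegral_Ioo_eq_intervalIntegral {F : Type*} [NormedAddCommGroup F] [NormedSpace ℝ F]
    (φ : ℝ → F) {t : ℝ} (ht : 0 ≤ t) :
    ∫ s in Set.Ioo 0 t, φ s = ∫ s in (0 : ℝ)..t, φ s := by
  rw [intervalIntegral.integral_of_le ht, integral_Ioc_eq_integral_Ioo]

/-- The components of the Duhamel right-hand side for a representative of a mild solution. -/
theorem duhamel_components (hν : 0 < ν) (hα : 1 / 2 < α) (hθ₀ : Continuous θ₀)
    (hu₀ : Continuous u₀) {Mf : ℝ} (hMf : ∀ y, ‖toState (θ₀ y) (u₀ y)‖ ≤ Mf)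
    {V₀ : ℝ → Plane → State} (hV : StronglyMeasurable (Function.uncurry V₀)) {M : ℝ}
    (hM : ∀ t x, ‖V₀ t x‖ ≤ M)
    (hae : ∀ᵐ s ∂volume.restrict (Set.Ioc 0 T),
      (fun y => toState (θ s y) (u s y)) =ᵐ[volume] V₀ s)
    {t : ℝ} (ht : t ∈ Set.Ioc 0 T) (x : Plane) :
    thetaComp (duhamel (scaledKernel (1 / (2 * α)) (0 + 2) (heatKernel ν α 1)) (sqgKernel ν α)
        (fun y => toState (θ₀ y) (u₀ y)) V₀ t x) =
      heatSemigroup ν α t θ₀ x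
        - ∫ s in (0 : ℝ)..t, gradHeat ν α (t - s) (fun y => θ s y • u s y) x ∧
    ∀ i, velComp i (duhamel (scaledKernel (1 / (2 * α)) (0 + 2) (heatKernel ν α 1))
        (sqgKernel ν α) (fun y => toState (θ₀ y) (u₀ y)) V₀ t x) =
      heatSemigroup ν α t (fun y => u₀ y i) x
        - ∫ s in (0 : ℝ)..t, gradHeatK ν α (t - s) i (fun y => θ s y • u s y) x := by
  have hγ : 1 / (2 * α) < 1 := by
    rw [div_lt_one (by linarith)]
    linarith
  obtain ⟨Cg, hg⟩ := isKernelFamily_heat hν hα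
  obtain ⟨C, hN⟩ := isKernelFamily_sqgKernel hν hα
  have hcoord : ∀ i : Fin 2, Continuous fun p : Plane => p i := fun i =>
    (EuclideanSpace.proj i : Plane →L[ℝ] ℝ).continuous
  have hfc : Continuous fun y => toState (θ₀ y) (u₀ y) :=
    hθ₀.prodMk (((hcoord 0).comp hu₀).prodMk ((hcoord 1).comp hu₀))
  have hi1 := integrable_smulConv (hg.integrable t ht.1) hfc hMf x
  have hi2 := integrableOn_quadConv_family hγ hN hV hM t x
  have hconv : ∀ π : State →L[ℝ] ℝ,
      π (smulConv (scaledKernel (1 / (2 * α)) (0 + 2) (heatKernel ν α 1) t)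
        (fun y => toState (θ₀ y) (u₀ y)) x) =
      heatSemigroup ν α t (fun y => π (toState (θ₀ y) (u₀ y))) x := by
    intro π
    rw [smulConv, ← π.integral_comp_comm hi1, heatSemigroup, ← integral_mul_comp_sub_eq_conv,
      heatKernel_eq_scaledKernel hα ht.1]
    simp only [map_smul, smul_eq_mul]
  have hquad : ∀ (π : State →L[ℝ] ℝ) (k : ℝ → Fin 2 → Plane → ℝ),
      (∀ τ, 0 < τ → ∀ j, Integrable (k τ j)) →
      (∀ τ, 0 < τ → ∀ z w, π (sqgKernel ν α τ z w w) =
        ∑ j, k τ j z * (thetaComp w * velComp j w)) →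
      π (∫ s in Set.Ioo 0 t, quadConv (sqgKernel ν α (t - s)) (V₀ s) x) =
        ∫ s in (0 : ℝ)..t, ∑ j, conv (k (t - s) j) (fun y => (θ s y • u s y) j) x := by
    intro π k hk hπ
    rw [← π.integral_comp_comm hi2, ← setIntegral_Ioo_eq_intervalIntegral _ ht.1.le]
    -- Inside the time integral, agreement of `V₀` with `(θ, u)` for almost every `s` and almost
    -- every `y` is enough.
    refine setIntegral_congr_ae measurableSet_Ioo ?_
    rw [ae_restrict_iff' measurableSet_Ioc] at hae
    filter_upwards [hae] with s hs hs'
    have hts : 0 < t - s := sub_pos.2 hs'.2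
    rw [clm_quadConv_eq (hN.integrable _ hts) (stronglyMeasurable_slice hV s) (hM s) π
      (hk _ hts) (hπ _ hts) x]
    refine Finset.sum_congr rfl fun j _ => conv_congr_ae _ ?_ x
    filter_upwards [hs ⟨hs'.1, hs'.2.le.trans ht.2⟩] with y hy
    rw [← hy, thetaComp_toState, velComp_toState]
    rfl
  refine ⟨?_, fun i => ?_⟩
  · rw [duhamel, map_sub, hconv, hquad thetaComp
      (fun τ j => partialDeriv j (heatKernel ν α τ)) (fun τ hτ j => ?_)
      (fun τ hτ => thetaComp_sqgKernel hν hα hτ)]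
    · simp only [thetaComp_toState]
      rfl
    · obtain ⟨_, h⟩ := isKernelFamily_gradHeat hν hα j
      rw [partialDeriv_heatKernel_eq hν hα j hτ]
      exact h.integrable τ hτ
  · rw [duhamel, map_sub, hconv, hquad (velComp i)
      (fun τ j => pvConvK i (partialDeriv j (heatKernel ν α τ))) (fun τ hτ j => ?_)
      (fun τ hτ => velComp_sqgKernel hν hα hτ i)]
    · simp only [velComp_toState]
      rfl
    · obtain ⟨_, h⟩ := isKernelFamily_gradHeatK hν hα i j
      rw [pvConvK_heatKernel_eq hν hα i j hτ]
      exact h.integrable τ hτ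

end MildSolutions

end DissipativeSQG

end

/-! ### The main theorem -/

theorem theorem1p2 (ν α : ℝ) (hν : 0 < ν) (hα : 1 / 2 < α) (k : ℕ) (hk : 1 ≤ k)
    (θ₀ : DissipativeSQG.Plane → ℝ) (u₀ : DissipativeSQG.Plane → DissipativeSQG.Plane)
    (hθ₀ : DissipativeSQG.IsCkb k θ₀)
    (hu₀ : ∀ i, DissipativeSQG.IsCkb k (fun x => u₀ x i))
    (hK : ∀ i x, DissipativeSQG.HasPVConvK i θ₀ x (u₀ x i))
    (T : ℝ) (hT : 0 < T)
    (θ : ℝ → DissipativeSQG.Plane → ℝ) (u : ℝ → DissipativeSQG.Plane → DissipativeSQG.Plane)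
    (hsol : DissipativeSQG.IsMildSolution ν α T θ₀ u₀ θ u) :
    ∃ M : ℝ, ∀ t ∈ Set.Icc (0 : ℝ) T,
      DissipativeSQG.HasCkBound k M (θ t) ∧
      ∀ i, DissipativeSQG.HasCkBound k M (fun x => u t x i) := by
  open DissipativeSQG in
  have hγ : 1 / (2 * α) < 1 := by
    rw [div_lt_one (by linarith)]
    linarith
  obtain ⟨Cg, hg⟩ := isKernelFamily_heat hν hα
  obtain ⟨C, hN⟩ := isKernelFamily_sqgKernel hν hα
  set f : Plane → State := fun y => toState (θ₀ y) (u₀ y) with hf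
  have hfk : ContDiff ℝ k f := hθ₀.1.prodMk ((hu₀ 0).1.prodMk (hu₀ 1).1)
  have hfb : ∀ j ≤ k, ∃ B, ∀ x, ‖iteratedFDeriv ℝ j f x‖ ≤ B := by
    intro j hj
    obtain ⟨B₁, h1⟩ := hθ₀.exists_iteratedFDeriv_bound j hj
    obtain ⟨B₂, h2⟩ := (hu₀ 0).exists_iteratedFDeriv_bound j hj
    obtain ⟨B₃, h3⟩ := (hu₀ 1).exists_iteratedFDeriv_bound j hj
    refine ⟨max B₁ (max B₂ B₃), fun x => ?_⟩
    have hj' : (j : WithTop ℕ∞) ≤ k := by exact_mod_cast hj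
    have e := iteratedFDeriv_prodMk hθ₀.1.contDiffAt
      ((hu₀ 0).1.prodMk (hu₀ 1).1).contDiffAt (x := x) hj'
    have e' := iteratedFDeriv_prodMk (hu₀ 0).1.contDiffAt (hu₀ 1).1.contDiffAt (x := x) hj'
    rw [e'] at e
    refine (congrArg norm e).trans_le ?_
    rw [ContinuousMultilinearMap.opNorm_prod, ContinuousMultilinearMap.opNorm_prod]
    exact max_le_max (h1 x) (max_le_max (h2 x) (h3 x))
  have hu₀c : Continuous u₀ := by
    refine (contDiff_euclidean (n := k) (𝕜 := ℝ)).2 (fun i => (hu₀ i).1) |>.continuous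
  obtain ⟨Mf, hMf⟩ := hfb 0 k.zero_le
  simp only [norm_iteratedFDeriv_zero] at hMf
  obtain ⟨M₀, V₀, hV, hM, hae⟩ := hsol.exists_representative
  have hcomp := fun (t : ℝ) (ht : t ∈ Set.Ioc 0 T) (x : Plane) =>
    duhamel_components hν hα hθ₀.1.continuous hu₀c hMf hV hM hae ht x
  -- `V₀` represents the solution only at almost every time, but the right-hand side built from `V₀`
  -- represents it at every `t` in `(0, T]`. This yields the conclusion for all times.
  have heq : ∀ t ∈ Set.Ioc 0 T, (fun y => toState (θ t y) (u t y)) =ᵐ[MeasureTheory.volume]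
      duhamel (scaledKernel (1 / (2 * α)) (0 + 2) (heatKernel ν α 1)) (sqgKernel ν α) f V₀ t := by
    intro t ht
    filter_upwards [hsol.theta_eq t ht, hsol.u_eq t ht] with x h1 h2
    refine state_ext ?_ fun j => ?_
    · rw [thetaComp_toState, h1]
      exact (hcomp t ht x).1.symm
    · rw [velComp_toState, h2 j]
      exact ((hcomp t ht x).2 j).symm
  obtain ⟨M, hsolV⟩ := isDuhamelSolution_of_ae hγ hT.le hg hN hfk.continuous hMf hV hM (by
    filter_upwards [hae, MeasureTheory.ae_restrict_mem measurableSet_Ioc] with t h1 h2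
    exact h1.symm.trans (heq t h2))
  obtain ⟨hVk, hVb⟩ := hsolV.contDiff hγ hg k hN hfk hfb
  choose! B₁ hB₁ using hfb
  choose! B₂ hB₂ using hVb
  have hB : ∀ (B : ℕ → ℝ) (j : ℕ), j ≤ k → B j ≤ ∑ i ∈ Finset.range (k + 1), |B i| := by
    intro B j hj
    exact (le_abs_self _).trans (Finset.single_le_sum (f := fun i => |B i|)
      (fun i _ => abs_nonneg _) (Finset.mem_range.2 (by lia)))
  refine ⟨max (∑ i ∈ Finset.range (k + 1), |B₁ i|) (∑ i ∈ Finset.range (k + 1), |B₂ i|),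
    fun t ht => ?_⟩
  -- Time zero is separate: the abstract solution is zero there by convention, so the data `f`
  -- serves as the representative, with its own bounds `B₁`.
  obtain ⟨G, hG, hGM, hGe⟩ : ∃ G : Plane → State, ContDiff ℝ k G ∧
      (∀ j ≤ k, ∀ x, ‖iteratedFDeriv ℝ j G x‖ ≤
        max (∑ i ∈ Finset.range (k + 1), |B₁ i|) (∑ i ∈ Finset.range (k + 1), |B₂ i|)) ∧
      (fun y => toState (θ t y) (u t y)) =ᵐ[MeasureTheory.volume] G := by
    rcases ht.1.eq_or_lt with rfl | h0
    · refine ⟨f, hfk, fun j hj x => le_max_of_le_left ((hB₁ j hj x).trans (hB B₁ j hj)), ?_⟩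
      filter_upwards [hsol.theta_zero, hsol.u_zero] with y h1 h2
      rw [hf, h1, h2]
    · refine ⟨_, hVk t, fun j hj x => le_max_of_le_right ((hB₂ j hj t x).trans (hB B₂ j hj)), ?_⟩
      rw [Set.indicator_of_mem (show t ∈ Set.Ioc 0 T from ⟨h0, ht.2⟩)]
      exact heq t ⟨h0, ht.2⟩
  refine ⟨hasCkBound_of_component hG hGM thetaComp norm_thetaComp_le ?_, fun i =>
    hasCkBound_of_component hG hGM (velComp i) (norm_velComp_le i) ?_⟩
  · filter_upwards [hGe] with y hy
    rw [← hy, thetaComp_toState]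
  · filter_upwards [hGe] with y hy
    rw [← hy, velComp_toState]
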